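/- Let $d\ge 1$, $\mathbb R^d_+=(0,\infty)^d$ with Lebesgue measure, and $\mathbb N=\{0,1,2,\dots\}$. For $\beta\in(-1,\infty)^d$ and $k\in\mathbb N^d$ let $$\mathcal L_k^\beta(x)=\prod_{i=1}^d\Big(\frac{\Gamma(k_i+1)}{\Gamma(k_i+\beta_i+1)}\Big)^{1/2}L_{k_i}^{\beta_i}(x_i)\,x_i^{\beta_i/2}e^{-x_i/2},\qquad x\in\mathbb R^d_+,$$ be the standard Laguerre functions, where $L_m^b$ is the Laguerre polynomial of degree $m$ and order $b$. Write $|k|=\sum_i k_i$, $|\beta|=\sum_i\beta_i$, and let $$G_t^{\beta}(x,y)=\sum_{n=0}^\infty e^{-t(n+(|\beta|+d)/2)}\sum_{|k|=n}\mathcal L_k^\beta(x)\mathcal L_k^\beta(y),\qquad t>0,\ x,y\in\mathbb R^d_+ .$$ Let $L_\beta$ be the self-adjoint operator on $L^2(\mathbb R^d_+)$ with $L_\beta\mathcal L_k^\beta=(|k|+(|\beta|+d)/2)\mathcal L_k^\beta$, $k\in\mathbb N^d$ (the standard Laguerre operator). **Proposition.** Fix $j\in\{1,\dots,d\}$ and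 $\alpha\in\mathbb R^d$ with $\alpha_j\ge-1$ and $\alpha_i\ge0$ for $i\ne j$, and let $e_j$ be the $j$th coordinate vector. Then the series for $G_t^{\alpha+e_j}(x,y)$ converges for all $t>0$ and $x,y\in\mathbb R^d_+$, and the operators $\widetilde T_0=\mathrm{Id}$ and $$\widetilde T_tf(x)=e^{-t/2}\int_{\mathbb R^d_+}G_t^{\alpha+e_j}(x,y)f(y)\,dy,\qquad t>0,\ x\in\mathbb R^d_+,$$ are well defined on $L^1(\mathbb R^d_+)+L^\infty(\mathbb R^d_+)$ (the integral converges absolutely for every $x\in\mathbb R^d_+$). On $L^2(\mathbb R^d_+)$ they coincide with the modified Laguerre semigroup $\exp(-t(L_{\alpha+e_j}+\tfrac12))$, that is, for $f\in L^2(\mathbb R^d_+)$ and $t\ge 0$, with convergence in $L^2$, $$\widetilde T_tf=\sum_{n=0}^\infty e^{-t(n+(|\alpha+e_j|+d)/2+1/2)}\sum_{|k|=n}\langle f,\mathcal L_k^{\alpha+e_j}\rangle\,\mathcal L_k^{\alpha+e_j}.$$ The family $\{\widetilde T_t\}_{t\ge0}$ is a submarkovian symmetric diffusion semigroup with domain $L^1+L^\infty$: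 the $\widetilde T_t$ are linear operators from $L^1+L^\infty$ to the measurable functions, $\widetilde T_0=\mathrm{Id}$; for each $1\le p\le\infty$ every $\widetilde T_t$ is a contraction on $L^p$ and $\{\widetilde T_t\}$ is a semigroup there; every $\widetilde T_t$ is self-adjoint on $L^2$; $\widetilde T_tf\to f$ in $L^2$ as $t\to0^+$ for each $f\in L^2$; $\widetilde T_tf\ge0$ whenever $f\ge0$; and $\widetilde T_t\mathbf 1\le\mathbf 1$ for all $t\ge0$. It is not Markovian, i.e. it is not true that $\widetilde T_t\mathbf 1=\mathbf 1$ for all $t$. Moreover, for every $1\le p\le\infty$, $$\|\widetilde T_t\|_{p\to p}\le e^{-t/2}\big(\cosh(t/2)\big)^{-d},\qquad t>0.$$ Scalars may be real or complex. -/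

import Mathlib

open MeasureTheory Filter Topology
open scoped ENNReal NNReal ComplexOrder

noncomputable section

/-! ### Symmetric diffusion semigroups

Operators act on (representatives of) classes of measurable functions; a domain `D` is a linear
space of a.e. strongly measurable functions, and all identities are meant almost everywhere. -/

section Abstract

variable {X 𝕜 : Type*} [MeasurableSpace X] [RCLike 𝕜]

/-- The space `L¹ + L^∞`. -/
def LOneAddLInfty (𝕜 : Type*) [RCLike 𝕜] (μ : Measure X) : Submodule 𝕜 (X → 𝕜) where
  carrier := {f | ∃ g h : X → 𝕜, MemLp g 1 μ ∧ MemLp h ∞ μ ∧ f = g + h}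
  zero_mem' := ⟨0, 0, MemLp.zero, MemLp.zero, by simp⟩
  add_mem' := by
    rintro _ _ ⟨g, h, hg, hh, rfl⟩ ⟨g', h', hg', hh', rfl⟩
    exact ⟨g + g', h + h', hg.add hg', hh.add hh', by abel⟩
  smul_mem' := by
    rintro c _ ⟨g, h, hg, hh, rfl⟩
    exact ⟨c • g, c • h, hg.const_smul c, hh.const_smul c, by simp⟩

/-- The operator norm `‖A‖_{p → p}`, the supremum of `‖A f‖_p` over the unit ball of `L^p`. -/
def lpOpNorm (μ : Measure X) (p : ℝ≥0∞) (A : (X → 𝕜) → (X → 𝕜)) : ℝ≥0∞ :=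
  ⨆ f : {f : X → 𝕜 // MemLp f p μ ∧ eLpNorm f p μ ≤ 1}, eLpNorm (A f) p μ

/-- A symmetric diffusion semigroup `(T_t)_{t ≥ 0}` with domain `D`. -/
structure IsSymmetricDiffusionSemigroup (μ : Measure X) (D : Submodule 𝕜 (X → 𝕜))
    (T : ℝ≥0 → (X → 𝕜) → (X → 𝕜)) : Prop where
  /-- `D` consists of measurable functions. -/
  measurable_of_mem : ∀ f ∈ D, AEStronglyMeasurable f μ
  /-- `D` contains all the `L^p` spaces. -/
  mem_of_memLp : ∀ p : ℝ≥0∞, 1 ≤ p → ∀ f : X → 𝕜, MemLp f p μ → f ∈ D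
  /-- `T_t` maps `D` into the measurable functions. -/
  measurable_map : ∀ t, ∀ f ∈ D, AEStronglyMeasurable (T t f) μ
  /-- `T_t` is well defined on classes of a.e. equal functions. -/
  congr : ∀ t, ∀ f ∈ D, ∀ g ∈ D, f =ᵐ[μ] g → T t f =ᵐ[μ] T t g
  /-- `T_t` is additive. -/
  map_add : ∀ t, ∀ f ∈ D, ∀ g ∈ D, T t (f + g) =ᵐ[μ] T t f + T t g
  /-- `T_t` is homogeneous. -/
  map_smul : ∀ t, ∀ c : 𝕜, ∀ f ∈ D, T t (c • f) =ᵐ[μ] c • T t f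
  /-- `T_0` is the identity. -/
  zero : ∀ f ∈ D, T 0 f =ᵐ[μ] f
  /-- `T_t` maps each `L^p` into itself. -/
  memLp : ∀ p : ℝ≥0∞, 1 ≤ p → ∀ t, ∀ f : X → 𝕜, MemLp f p μ → MemLp (T t f) p μ
  /-- `T_t` is a contraction on each `L^p`. -/
  contraction : ∀ p : ℝ≥0∞, 1 ≤ p → ∀ t, lpOpNorm μ p (T t) ≤ 1
  /-- The semigroup property on each `L^p`. -/
  semigroup : ∀ p : ℝ≥0∞, 1 ≤ p → ∀ s t, ∀ f : X → 𝕜, MemLp f p μ →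
    T (s + t) f =ᵐ[μ] T s (T t f)
  /-- `T_t` is self-adjoint on `L²` (it is bounded and everywhere defined there). -/
  selfAdjoint : ∀ t, ∀ f g : X → 𝕜, MemLp f 2 μ → MemLp g 2 μ →
    ∫ x, inner 𝕜 (T t f x) (g x) ∂μ = ∫ x, inner 𝕜 (f x) (T t g x) ∂μ
  /-- Strong continuity at `0` on `L²`. -/
  tendsto : ∀ f : X → 𝕜, MemLp f 2 μ →
    Tendsto (fun t : ℝ≥0 => eLpNorm (T t f - f) 2 μ) (𝓝[>] 0) (𝓝 0)

/-- Positivity; for complex scalars, `0 ≤ z` means that `z` is real and nonnegative. -/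
def IsPositivityPreserving (μ : Measure X) (D : Submodule 𝕜 (X → 𝕜))
    (T : ℝ≥0 → (X → 𝕜) → (X → 𝕜)) : Prop :=
  ∀ t, ∀ f ∈ D, (∀ᵐ x ∂μ, 0 ≤ f x) → ∀ᵐ x ∂μ, 0 ≤ T t f x

/-- A Markovian symmetric diffusion semigroup: positive, and `T_t 1 = 1` for all `t`. -/
def IsMarkovian (μ : Measure X) (D : Submodule 𝕜 (X → 𝕜))
    (T : ℝ≥0 → (X → 𝕜) → (X → 𝕜)) : Prop :=
  IsSymmetricDiffusionSemigroup μ D T ∧ IsPositivityPreserving μ D T ∧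
    ∀ t, ∀ᵐ x ∂μ, T t (fun _ => 1) x = 1

/-- A submarkovian symmetric diffusion semigroup: positive, and `T_t 1 ≤ 1` for all `t`. -/
def IsSubmarkovian (μ : Measure X) (D : Submodule 𝕜 (X → 𝕜))
    (T : ℝ≥0 → (X → 𝕜) → (X → 𝕜)) : Prop :=
  IsSymmetricDiffusionSemigroup μ D T ∧ IsPositivityPreserving μ D T ∧
    ∀ t, ∀ᵐ x ∂μ, T t (fun _ => 1) x ≤ 1

end Abstract

/-! ### Standard Laguerre functions -/

/-- The Laguerre polynomial of degree `k` and order `a > -1`,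
`L_k^a(x) = ∑_{i ≤ k} Γ(k+a+1) / Γ(i+a+1) * (-x)^i / (i! (k-i)!)`. -/
def laguerrePoly (a : ℝ) (k : ℕ) (x : ℝ) : ℝ :=
  ∑ i ∈ Finset.range (k + 1), Real.Gamma (k + a + 1) / Real.Gamma (i + a + 1) *
    ((-x) ^ i / ((i.factorial : ℝ) * ((k - i).factorial : ℝ)))

/-- The one-dimensional standard Laguerre function of order `a > -1` on `(0, ∞)`. -/
def laguerreFun (a : ℝ) (k : ℕ) (x : ℝ) : ℝ :=
  Real.sqrt (Real.Gamma (k + 1) / Real.Gamma (k + a + 1)) * laguerrePoly a k x *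
    x ^ (a / 2) * Real.exp (-x / 2)

/-- The multi-dimensional standard Laguerre functions are tensor products. -/
def laguerreFunPi {d : ℕ} (a : Fin d → ℝ) (k : Fin d → ℕ) (x : Fin d → ℝ) : ℝ :=
  ∏ i, laguerreFun (a i) (k i) (x i)

/-- The open positive orthant in `ℝ^d`. -/
def posOrthant (d : ℕ) : Set (Fin d → ℝ) := {x | ∀ i, 0 < x i}

/-- Lebesgue measure on the open positive orthant. -/
def orthantVolume (d : ℕ) : Measure (Fin d → ℝ) := volume.restrict (posOrthant d)

/-- The eigenvalue `n + (|a| + d) / 2` of the standard Laguerre operator that belongs to the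
Laguerre functions with multi-index of length `n`. -/
def laguerreEigenvalue {d : ℕ} (a : Fin d → ℝ) (n : ℕ) : ℝ := n + ((∑ i, a i) + d) / 2

/-- The `n`-th term of the series of the heat kernel at time `t`. -/
def laguerreKernelTerm {d : ℕ} (a : Fin d → ℝ) (t : ℝ) (x y : Fin d → ℝ) (n : ℕ) : ℝ :=
  Real.exp (-t * laguerreEigenvalue a n) *
    ∑ k ∈ Finset.piAntidiag Finset.univ n, laguerreFunPi a k x * laguerreFunPi a k y

/-- The heat kernel of the standard Laguerre semigroup of order `a`. -/
def laguerreKernel {d : ℕ} (a : Fin d → ℝ) (t : ℝ) (x y : Fin d → ℝ) : ℝ :=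
  ∑' n, laguerreKernelTerm a t x y n

/-! ### The modified standard Laguerre semigroup -/

section Modified

variable {𝕜 : Type*} [RCLike 𝕜] {d : ℕ}

/-- The shifted order `α + e_j`. -/
def shiftOrder (α : Fin d → ℝ) (j : Fin d) : Fin d → ℝ := α + Pi.single j 1

/-- The spectral definition of the modified semigroup on `L²`: the `N`-th partial sum (multi-indices
of length `n < N`) of the expansion of `exp(-t (L + 1/2)) f`, where `L` is the self-adjoint
Laguerre operator of order `α + e_j`. -/
def modifiedSpectralPartialSum (α : Fin d → ℝ) (j : Fin d) (t : ℝ≥0) (f : (Fin d → ℝ) → 𝕜)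
    (N : ℕ) : (Fin d → ℝ) → 𝕜 := fun x =>
  ∑ n ∈ Finset.range N, Real.exp (-(t : ℝ) * (laguerreEigenvalue (shiftOrder α j) n + 1 / 2)) •
    ∑ k ∈ Finset.piAntidiag Finset.univ n, laguerreFunPi (shiftOrder α j) k x •
      ∫ y, laguerreFunPi (shiftOrder α j) k y • f y ∂(orthantVolume d)

/-- The modified semigroup on `L¹ + L^∞`: the identity for `t = 0`, and the integral operator with
kernel `exp(-t/2) G_t^{α + e_j}(x, y)` for `t > 0`. -/
def modifiedLaguerre (α : Fin d → ℝ) (j : Fin d) (t : ℝ≥0) (f : (Fin d → ℝ) → 𝕜) :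
    (Fin d → ℝ) → 𝕜 :=
  if t = 0 then f
  else fun x => Real.exp (-(t : ℝ) / 2) •
    ∫ y, laguerreKernel (shiftOrder α j) t x y • f y ∂(orthantVolume d)

end Modified

end

/-!
For orders `β i ≥ 0` the kernel `G_t^β` has the closed form of Hille and Hardy: with `r = exp (-t)`
it is a product over the coordinates of kernels built from the series
`∑ m, z ^ m / (m! Γ(m + b + 1))` of a modified Bessel function. That kernel is nonnegative and
symmetric, and integrating its Bessel series against a Laguerre function term by term shows that the
Laguerre functions are eigenfunctions, with eigenvalue `r ^ (k + (b + 1) / 2)`. Its mass in one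
coordinate is at most `2 √r / (1 + r) = 1 / cosh (t / 2)`; this rests on
`Γ(m + b / 2 + 1) ^ 2 ≤ Γ(m + 1) Γ(m + b + 1)` (log-convexity of `Γ`) and on
`∑ m, z ^ (m + a) / Γ(m + a + 1) ≤ exp z` for `a ≥ 0`. Schur's test turns the bound on the mass into
the bound on every `L^p`.

The Laguerre functions form a Hilbert basis because the Gamma distributions are determined by their
moments. Parseval's identity for the rows of the closed-form kernel at time `t / 2` then gives the
absolute convergence of the series for `G_t^β` everywhere, its agreement with the closed form almost
everywhere, and the semigroup law. Strong continuity is dominated convergence for the coefficients.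
-/

/-! ### Gamma function -/

theorem Gamma_natCast_add_add_one_pos {b : ℝ} (hb : -1 < b) (m : ℕ) :
    0 < Real.Gamma (m + b + 1) := by
  have : (0 : ℝ) ≤ m := m.cast_nonneg
  exact Real.Gamma_pos_of_pos (by linarith)

theorem factorial_mul_Gamma_le {b : ℝ} (hb : 0 ≤ b) (m : ℕ) :
    m.factorial * Real.Gamma (b + 1) ≤ Real.Gamma (m + b + 1) := by
  induction m with
  | zero => simp
  | succ m ih =>
    have := Gamma_natCast_add_add_one_pos (by linarith : -1 < b) m
    calc ((m + 1).factorial : ℝ) * Real.Gamma (b + 1)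
        = (m + 1) * (m.factorial * Real.Gamma (b + 1)) := by
          rw [Nat.factorial_succ]
          push_cast
          ring
      _ ≤ (m + b + 1) * Real.Gamma (m + b + 1) := by gcongr; linarith
      _ = Real.Gamma ((m + 1 : ℕ) + b + 1) := by
          rw [← Real.Gamma_add_one (by positivity)]
          push_cast
          ring_nf

theorem Gamma_natCast_add_half_add_one_sq_le {b : ℝ} (hb : -1 < b) (m : ℕ) :
    Real.Gamma (m + b / 2 + 1) ^ 2 ≤ m.factorial * Real.Gamma (m + b + 1) := by
  have : (0 : ℝ) ≤ m := m.cast_nonneg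
  have log_convex := Real.Gamma_mul_add_mul_le_rpow_Gamma_mul_rpow_Gamma (s := m + 1)
    (t := m + b + 1) (a := 1 / 2) (b := 1 / 2) (by linarith) (by linarith) one_half_pos
    one_half_pos (add_halves 1)
  have midpoint : (1 / 2 : ℝ) * (m + 1) + 1 / 2 * (m + b + 1) = m + b / 2 + 1 := by ring
  rw [midpoint, ← Real.sqrt_eq_rpow, ← Real.sqrt_eq_rpow, Real.Gamma_nat_eq_factorial]
    at log_convex
  have hpos : 0 < Real.Gamma (m + b / 2 + 1) := Real.Gamma_pos_of_pos (by linarith)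
  calc Real.Gamma (m + b / 2 + 1) ^ 2
      ≤ (√m.factorial * √(Real.Gamma (m + b + 1))) ^ 2 := by gcongr
    _ = m.factorial * Real.Gamma (m + b + 1) := by
      rw [mul_pow, Real.sq_sqrt (by positivity),
        Real.sq_sqrt (Gamma_natCast_add_add_one_pos hb m).le]

theorem Gamma_add_one_eq_descPochhammer_mul_Gamma {c : ℝ} (k : ℕ) (hk : k < c + 1) :
    Real.Gamma (c + 1) = (descPochhammer ℝ k).eval c * Real.Gamma (c - k + 1) := by
  induction k with
  | zero => simp
  | succ k ih =>
    push_cast at hk ⊢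
    rw [ih (by linarith), descPochhammer_succ_eval, Real.Gamma_add_one (by linarith)]
    ring_nf

theorem hasSum_pow_div_factorial (z : ℝ) :
    HasSum (fun m : ℕ => z ^ m / m.factorial) (Real.exp z) := by
  rw [Real.exp_eq_exp_ℝ]
  exact NormedSpace.expSeries_div_hasSum_exp z

theorem hasSum_pow_div_factorial_mul_descFactorial (i : ℕ) (z : ℝ) :
    HasSum (fun m : ℕ => z ^ m / m.factorial * m.descFactorial i) (z ^ i * Real.exp z) := by
  rw [← hasSum_nat_add_iff' i, Finset.sum_eq_zero, sub_zero]
  · refine ((hasSum_pow_div_factorial z).mul_left (z ^ i)).congr_fun fun m => ?_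
    have h := Nat.factorial_mul_descFactorial (n := m + i) (k := i) (by omega)
    rw [Nat.add_sub_cancel] at h
    rw [← h]
    have := Nat.descFactorial_pos.2 (show i ≤ m + i by omega)
    push_cast
    field_simp
    ring
  · intro m hm
    rw [Nat.descFactorial_eq_zero_iff_lt.2 (Finset.mem_range.1 hm), Nat.cast_zero, mul_zero]

theorem Gamma_natCast_add_natCast_add_div_Gamma {b : ℝ} (hb : -1 < b) (m k : ℕ) :
    Real.Gamma (m + k + b + 1) / Real.Gamma (m + b + 1) =
      ∑ i ∈ Finset.range (k + 1), k.choose i * m.descFactorial i *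
        (Real.Gamma (k + b + 1) / Real.Gamma (i + b + 1)) := by
  have : (0 : ℝ) ≤ m := m.cast_nonneg
  have hGm := Gamma_natCast_add_add_one_pos hb m
  have ratio : Real.Gamma (m + k + b + 1) / Real.Gamma (m + b + 1) =
      (descPochhammer ℝ k).eval (m + (k + b)) := by
    rw [div_eq_iff hGm.ne', show (m : ℝ) + k + b = m + (k + b) by ring,
      Gamma_add_one_eq_descPochhammer_mul_Gamma k (by linarith)]
    ring_nf
  have eval_eq_smeval (n : ℕ) (x : ℝ) :
      (descPochhammer ℝ n).eval x = (descPochhammer ℤ n).smeval x := by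
    rw [← Polynomial.aeval_eq_smeval, ← Polynomial.eval_map_algebraMap, descPochhammer_map]
  -- Chu–Vandermonde for the falling factorial of `m + (k + b)`
  rw [ratio, eval_eq_smeval, Ring.descPochhammer_smeval_add k (Commute.all _ _),
    Finset.Nat.sum_antidiagonal_eq_sum_range_succ (fun i l => (k.choose i : ℝ) *
      ((descPochhammer ℤ i).smeval (m : ℝ) * (descPochhammer ℤ l).smeval (k + b)))]
  refine Finset.sum_congr rfl fun i hi => ?_
  have hik : i ≤ k := Nat.lt_succ_iff.1 (Finset.mem_range.1 hi)
  have hGi := Gamma_natCast_add_add_one_pos hb i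
  have : (0 : ℝ) ≤ i := i.cast_nonneg
  rw [Polynomial.descPochhammer_smeval_eq_descFactorial, ← eval_eq_smeval, mul_assoc,
    Gamma_add_one_eq_descPochhammer_mul_Gamma (c := k + b) (k - i)
      (by rw [Nat.cast_sub hik]; linarith), Nat.cast_sub hik,
    show (k : ℝ) + b - (k - i) + 1 = i + b + 1 by ring, mul_div_cancel_right₀ _ hGi.ne']

theorem hasSum_pow_div_factorial_mul_Gamma_ratio {b : ℝ} (hb : -1 < b) (k : ℕ) (z : ℝ) :
    HasSum (fun m : ℕ => z ^ m / m.factorial *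
        (Real.Gamma (m + k + b + 1) / Real.Gamma (m + b + 1)))
      (Real.exp z * ∑ i ∈ Finset.range (k + 1), k.choose i * z ^ i *
        (Real.Gamma (k + b + 1) / Real.Gamma (i + b + 1))) := by
  simp only [Gamma_natCast_add_natCast_add_div_Gamma hb, Finset.mul_sum]
  refine hasSum_sum fun i _ => ?_
  generalize Real.Gamma (k + b + 1) / Real.Gamma (i + b + 1) = ratio
  rw [show Real.exp z * (k.choose i * z ^ i * ratio) =
    k.choose i * ratio * (z ^ i * Real.exp z) by ring]
  exact ((hasSum_pow_div_factorial_mul_descFactorial i z).mul_left _).congr_fun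
    fun m => by ring

theorem sum_neg_one_pow_mul_choose_mul_eval_of_monic {P : Polynomial ℝ} (hP : P.Monic) {n : ℕ}
    (hn : P.natDegree ≤ n) :
    ∑ k ∈ Finset.range (n + 1), (-1) ^ k * (n.choose k : ℝ) * P.eval (k : ℝ) =
      if P.natDegree = n then (-1) ^ n * (n.factorial : ℝ) else 0 := by
  have sum_eq : ∑ k ∈ Finset.range (n + 1), (-1) ^ k * (n.choose k : ℝ) * P.eval (k : ℝ) =
      (-1) ^ n * (fwdDiff 1)^[n] P.eval 0 := by
    rw [fwdDiff_iter_eq_sum_shift, Finset.mul_sum]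
    refine Finset.sum_congr rfl fun k hk => ?_
    obtain ⟨p, rfl⟩ := Nat.exists_eq_add_of_le (Nat.lt_succ_iff.1 (Finset.mem_range.1 hk))
    have sign : (-1 : ℝ) ^ (k + p) * (-1) ^ p = (-1) ^ k := by
      rw [pow_add, mul_assoc, ← mul_pow]
      simp
    rw [zero_add, nsmul_one, zsmul_eq_mul, Nat.add_sub_cancel_left, ← sign]
    push_cast
    ring
  rw [sum_eq]
  split_ifs with h
  · have := P.fwdDiff_iter_degree_eq_factorial
    rw [h] at this
    rw [this, hP.leadingCoeff]
    simp
  · rw [Polynomial.fwdDiff_iter_eq_zero_of_degree_lt (lt_of_le_of_ne hn h)]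
    simp

theorem sum_neg_one_pow_mul_choose_mul_Gamma_ratio {b : ℝ} (hb : -1 < b) {n j : ℕ} (hj : j ≤ n) :
    ∑ k ∈ Finset.range (n + 1), (-1) ^ k * (n.choose k : ℝ) *
        (Real.Gamma (k + j + b + 1) / Real.Gamma (k + b + 1)) =
      if j = n then (-1) ^ n * (n.factorial : ℝ) else 0 := by
  set P : Polynomial ℝ := (descPochhammer ℝ j).comp (Polynomial.X + Polynomial.C (j + b)) with hP
  have monic : P.Monic := (monic_descPochhammer ℝ j).comp (Polynomial.monic_X_add_C _)
    (by rw [Polynomial.natDegree_X_add_C]; exact one_ne_zero)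
  have natDegree : P.natDegree = j := by
    rw [hP, Polynomial.natDegree_comp, descPochhammer_natDegree, Polynomial.natDegree_X_add_C,
      mul_one]
  have ratio (k : ℕ) : Real.Gamma (k + j + b + 1) / Real.Gamma (k + b + 1) = P.eval (k : ℝ) := by
    have : (0 : ℝ) ≤ k := k.cast_nonneg
    rw [div_eq_iff (Gamma_natCast_add_add_one_pos hb k).ne', hP, Polynomial.eval_comp,
      Polynomial.eval_add, Polynomial.eval_X, Polynomial.eval_C,
      show (k : ℝ) + j + b = k + (j + b) by ring,
      Gamma_add_one_eq_descPochhammer_mul_Gamma j (by linarith)]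
    ring_nf
  simp only [ratio]
  rw [sum_neg_one_pow_mul_choose_mul_eval_of_monic monic (by rwa [natDegree]), natDegree]

theorem sum_choose_mul_choose_mul_neg_one_pow {n i : ℕ} (hi : i ≤ n) (v : ℝ) :
    ∑ k ∈ Finset.range (n + 1), (n.choose k : ℝ) * k.choose i * (-1) ^ k * v ^ (k - i) =
      n.choose i * (-1) ^ i * (1 - v) ^ (n - i) := by
  obtain ⟨p, rfl⟩ := Nat.exists_eq_add_of_le hi
  rw [add_assoc, Finset.sum_range_add, Finset.sum_eq_zero, zero_add, Nat.add_sub_cancel_left,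
    sub_eq_add_neg, add_comm (1 : ℝ), add_pow, Finset.mul_sum]
  · refine Finset.sum_congr rfl fun k _ => ?_
    have choose_mul : ((i + p).choose (i + k) : ℝ) * ((i + k).choose i) =
        (i + p).choose i * p.choose k := by
      have := Nat.choose_mul (n := i + p) (k := i + k) (s := i) (by omega)
      rw [Nat.add_sub_cancel_left, Nat.add_sub_cancel_left] at this
      exact_mod_cast this
    rw [Nat.add_sub_cancel_left, pow_add, one_pow, neg_pow v k, choose_mul]
    ring
  · intro k hk
    rw [Nat.choose_eq_zero_of_lt (Finset.mem_range.1 hk)]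
    simp

theorem integrableOn_rpow_mul_exp_neg_mul {c p : ℝ} (hc : -1 < c) (hp : 0 < p) :
    IntegrableOn (fun u => u ^ c * Real.exp (-(p * u))) (Set.Ioi 0) := by
  simpa only [Real.rpow_one, neg_mul] using
    integrableOn_rpow_mul_exp_neg_mul_rpow (p := 1) hc one_pos hp

/-- The regularized upper incomplete Gamma function `Γ(c, s) / Γ(c)`; its recursion in `c` makes the
sums `∑ m, s ^ (m + a) / Γ(m + a + 1)` telescope. -/
noncomputable def regularizedUpperGamma (c s : ℝ) : ℝ :=
  (∫ u in Set.Ioi s, u ^ (c - 1) * Real.exp (-u)) / Real.Gamma c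

section regularizedUpperGamma

variable {c s : ℝ}

theorem integrableOn_Ioi_rpow_sub_one_mul_exp_neg (hc : 0 < c) (hs : 0 ≤ s) :
    IntegrableOn (fun u => u ^ (c - 1) * Real.exp (-u)) (Set.Ioi s) := by
  have h := integrableOn_rpow_mul_exp_neg_mul (c := c - 1) (by linarith) one_pos
  simp only [one_mul] at h
  exact h.mono_set (Set.Ioi_subset_Ioi hs)

theorem regularizedUpperGamma_nonneg (hc : 0 < c) (hs : 0 ≤ s) :
    0 ≤ regularizedUpperGamma c s := by
  refine div_nonneg (setIntegral_nonneg measurableSet_Ioi fun u hu => ?_)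
    (Real.Gamma_pos_of_pos hc).le
  have : 0 ≤ u := hs.trans (le_of_lt hu)
  positivity

theorem regularizedUpperGamma_le_one (hc : 0 < c) (hs : 0 ≤ s) :
    regularizedUpperGamma c s ≤ 1 := by
  rw [regularizedUpperGamma, div_le_one (Real.Gamma_pos_of_pos hc), Real.Gamma_eq_integral hc]
  simp only [mul_comm (Real.exp _)]
  refine setIntegral_mono_set (integrableOn_Ioi_rpow_sub_one_mul_exp_neg hc le_rfl) ?_
    (Set.Ioi_subset_Ioi hs).eventuallyLE
  filter_upwards [ae_restrict_mem measurableSet_Ioi] with u hu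
  have : (0 : ℝ) ≤ u := le_of_lt hu
  simp only [Pi.zero_apply]
  positivity

theorem integral_Ioi_rpow_mul_exp_neg (hc : 0 < c) (hs : 0 ≤ s) :
    ∫ u in Set.Ioi s, u ^ c * Real.exp (-u) =
      c * (∫ u in Set.Ioi s, u ^ (c - 1) * Real.exp (-u)) + s ^ c * Real.exp (-s) := by
  have int_succ : IntegrableOn (fun u => u ^ c * Real.exp (-u)) (Set.Ioi s) := by
    simpa using integrableOn_Ioi_rpow_sub_one_mul_exp_neg (c := c + 1) (by linarith) hs
  have int := integrableOn_Ioi_rpow_sub_one_mul_exp_neg hc hs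
  have ftc := integral_Ioi_of_hasDerivAt_of_tendsto (a := s) (m := 0)
    (f := fun u => u ^ c * Real.exp (-u))
    (f' := fun u => c * (u ^ (c - 1) * Real.exp (-u)) - u ^ c * Real.exp (-u)) ?_ ?_ ?_ ?_
  · rw [integral_sub (int.const_mul c) int_succ, integral_const_mul] at ftc
    linarith
  · exact ((Real.continuous_rpow_const hc.le).mul
      (Real.continuous_exp.comp continuous_neg)).continuousWithinAt
  · intro u hu
    have hu0 : u ≠ 0 := (hs.trans_lt hu).ne'
    exact ((Real.hasDerivAt_rpow_const (Or.inl hu0)).mul (hasDerivAt_neg u).exp).congr_deriv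
      (by ring)
  · exact (int.const_mul c).sub int_succ
  · simpa using tendsto_rpow_mul_exp_neg_mul_atTop_nhds_zero c 1 one_pos

theorem regularizedUpperGamma_add_one (hc : 0 < c) (hs : 0 ≤ s) :
    regularizedUpperGamma (c + 1) s =
      regularizedUpperGamma c s + s ^ c / Real.Gamma (c + 1) * Real.exp (-s) := by
  have := Real.Gamma_pos_of_pos hc
  simp only [regularizedUpperGamma, add_sub_cancel_right]
  rw [integral_Ioi_rpow_mul_exp_neg hc hs, Real.Gamma_add_one hc.ne']
  field_simp

end regularizedUpperGamma

theorem sum_rpow_div_Gamma_le_exp {a s : ℝ} (ha : 0 ≤ a) (hs : 0 ≤ s) (N : ℕ) :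
    ∑ m ∈ Finset.range N, s ^ (m + a) / Real.Gamma (m + a + 1) ≤ Real.exp s := by
  rcases ha.eq_or_lt with rfl | ha
  · simpa [Real.Gamma_nat_eq_factorial] using
      sum_le_hasSum (Finset.range N) (fun m _ => by positivity) (hasSum_pow_div_factorial s)
  have telescope : (∑ m ∈ Finset.range N, s ^ (m + a) / Real.Gamma (m + a + 1)) * Real.exp (-s) =
      regularizedUpperGamma (N + a) s - regularizedUpperGamma (0 + a) s := by
    rw [Finset.sum_mul, ← Nat.cast_zero (R := ℝ),
      ← Finset.sum_range_sub fun m : ℕ => regularizedUpperGamma (m + a) s]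
    refine Finset.sum_congr rfl fun m _ => ?_
    rw [Nat.cast_succ, add_right_comm (m : ℝ) 1 a, regularizedUpperGamma_add_one (by positivity) hs,
      add_sub_cancel_left]
  have le_one : (∑ m ∈ Finset.range N, s ^ (m + a) / Real.Gamma (m + a + 1)) * Real.exp (-s) ≤
      1 := by
    rw [telescope]
    linarith [regularizedUpperGamma_le_one (c := N + a) (by positivity) hs,
      regularizedUpperGamma_nonneg (c := 0 + a) (by positivity) hs]
  rwa [Real.exp_neg, ← div_eq_mul_inv, div_le_one (Real.exp_pos s)] at le_one

theorem rpow_mul_exp_neg_mul_le {s δ x : ℝ} (hs : 0 ≤ s) (hδ : 0 < δ) (hx : 0 ≤ x) :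
    x ^ s * Real.exp (-(δ * x)) ≤ ((s + 1) / δ) ^ s := by
  have le_exp : δ * x / (s + 1) ≤ Real.exp (δ * x / (s + 1)) := by
    linarith [Real.add_one_le_exp (δ * x / (s + 1))]
  rw [Real.exp_neg, ← div_eq_mul_inv, div_le_iff₀ (Real.exp_pos _)]
  calc x ^ s = ((s + 1) / δ) ^ s * (δ * x / (s + 1)) ^ s := by
        rw [← Real.mul_rpow (by positivity) (by positivity)]
        congr 1
        field_simp
    _ ≤ ((s + 1) / δ) ^ s * Real.exp (δ * x / (s + 1)) ^ s := by gcongr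
    _ ≤ ((s + 1) / δ) ^ s * Real.exp (δ * x) := by
        rw [← Real.exp_mul]
        refine mul_le_mul_of_nonneg_left (Real.exp_le_exp.2 ?_) (by positivity)
        rw [div_mul_eq_mul_div, div_le_iff₀ (by positivity)]
        exact mul_le_mul_of_nonneg_left (by linarith) (by positivity)

/-! ### Bessel series -/

/-- The series `∑ z^m / (m! Γ(m+b+1))`, an entire function of `z` in terms of which the modified
Bessel function of order `b` is `I_b(x) = (x/2)^b * besselSeries b (x²/4)`. -/
noncomputable def besselSeries (b z : ℝ) : ℝ :=
  ∑' m : ℕ, z ^ m / (m.factorial * Real.Gamma (m + b + 1))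

section besselSeries

variable {b : ℝ}

theorem summable_besselSeries (hb : 0 ≤ b) (z : ℝ) :
    Summable fun m : ℕ => z ^ m / (m.factorial * Real.Gamma (m + b + 1)) := by
  have hG0 : 0 < Real.Gamma (b + 1) := Real.Gamma_pos_of_pos (by positivity)
  refine Summable.of_norm_bounded
    ((hasSum_pow_div_factorial |z|).summable.div_const (Real.Gamma (b + 1))) fun m => ?_
  have hG : Real.Gamma (b + 1) ≤ Real.Gamma (m + b + 1) :=
    (le_mul_of_one_le_left hG0.le (by exact_mod_cast m.factorial_pos)).trans
      (factorial_mul_Gamma_le hb m)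
  rw [norm_div, norm_mul, norm_pow, Real.norm_eq_abs, Real.norm_of_nonneg (hG0.le.trans hG),
    Real.norm_natCast, div_div]
  gcongr

theorem besselSeries_nonneg {z : ℝ} (hb : -1 < b) (hz : 0 ≤ z) : 0 ≤ besselSeries b z :=
  tsum_nonneg fun m => by
    have := Gamma_natCast_add_add_one_pos hb m
    positivity

theorem besselSeries_mul_le {u v : ℝ} (hb : 0 ≤ b) (hu : 0 ≤ u) (hv : 0 ≤ v) :
    besselSeries b (u * v) ≤ Real.exp u * Real.exp v / Real.Gamma (b + 1) := by
  have : 0 < Real.Gamma (b + 1) := Real.Gamma_pos_of_pos (by positivity)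
  have sum_bound := ((hasSum_pow_div_factorial u).mul_right (Real.exp v)).div_const
    (Real.Gamma (b + 1))
  rw [← sum_bound.tsum_eq]
  refine (summable_besselSeries hb _).tsum_le_tsum (fun m => ?_) sum_bound.summable
  have hG := factorial_mul_Gamma_le hb m
  calc (u * v) ^ m / (m.factorial * Real.Gamma (m + b + 1))
      ≤ (u * v) ^ m / (m.factorial * (m.factorial * Real.Gamma (b + 1))) := by gcongr
    _ = u ^ m / m.factorial * (v ^ m / m.factorial) / Real.Gamma (b + 1) := by
      rw [mul_pow]; field_simp
    _ ≤ u ^ m / m.factorial * Real.exp v / Real.Gamma (b + 1) := by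
      gcongr
      exact Real.pow_div_factorial_le_exp v hv m

theorem measurable_besselSeries (hb : 0 ≤ b) : Measurable (besselSeries b) := by
  refine measurable_of_tendsto_metrizable
    (f := fun N z => ∑ m ∈ Finset.range N, z ^ m / (m.factorial * Real.Gamma (m + b + 1)))
    (fun N => by fun_prop) (tendsto_pi_nhds.2 fun z => ?_)
  exact (summable_besselSeries hb z).hasSum.tendsto_sum_nat

theorem integral_rpow_mul_exp_mul_besselSeries {c p w S : ℝ} (hb : -1 < b) (hc : -1 < c)
    (hp : 0 < p) (hw : 0 ≤ w)
    (hS : HasSum (fun m : ℕ => w ^ m / (m.factorial * Real.Gamma (m + b + 1)) *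
      ((1 / p) ^ (m + c + 1) * Real.Gamma (m + c + 1))) S) :
    ∫ y in Set.Ioi 0, y ^ c * Real.exp (-(p * y)) * besselSeries b (w * y) = S := by
  set F : ℕ → ℝ → ℝ := fun m y => w ^ m / (m.factorial * Real.Gamma (m + b + 1)) *
    (y ^ (m + c) * Real.exp (-(p * y))) with hF
  have exponent_gt (m : ℕ) : (-1 : ℝ) < m + c := by
    linarith [(Nat.cast_nonneg m : (0 : ℝ) ≤ m)]
  have integrable_F (m : ℕ) : IntegrableOn (F m) (Set.Ioi 0) :=
    (integrableOn_rpow_mul_exp_neg_mul (exponent_gt m) hp).const_mul _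
  have integral_F (m : ℕ) : ∫ y in Set.Ioi 0, F m y =
      w ^ m / (m.factorial * Real.Gamma (m + b + 1)) *
        ((1 / p) ^ (m + c + 1) * Real.Gamma (m + c + 1)) := by
    rw [hF, integral_const_mul, ← Real.integral_rpow_mul_exp_neg_mul_Ioi
      (by linarith [exponent_gt m]) hp, add_sub_cancel_right]
  have integral_norm_F (m : ℕ) : ∫ y in Set.Ioi 0, ‖F m y‖ = ∫ y in Set.Ioi 0, F m y := by
    refine setIntegral_congr_fun measurableSet_Ioi fun y (hy : 0 < y) => Real.norm_of_nonneg ?_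
    have := Gamma_natCast_add_add_one_pos hb m
    positivity
  have termwise := hasSum_integral_of_summable_integral_norm integrable_F
    (by simpa only [integral_norm_F, integral_F] using hS.summable)
  simp only [integral_F] at termwise
  rw [hS.unique termwise]
  refine setIntegral_congr_fun measurableSet_Ioi fun y (hy : 0 < y) => ?_
  simp only [besselSeries, hF, ← tsum_mul_left]
  refine tsum_congr fun m => ?_
  rw [Real.rpow_add hy, Real.rpow_natCast, mul_pow]
  ring

theorem laplace_besselSeries_term_le {p w : ℝ} (hb : -1 < b) (hp : 0 < p) (hw : 0 < w) (m : ℕ) :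
    w ^ m / (m.factorial * Real.Gamma (m + b + 1)) *
        ((1 / p) ^ (m + b / 2 + 1) * Real.Gamma (m + b / 2 + 1)) ≤
      w ^ (-(b / 2)) / p * ((w / p) ^ (m + b / 2) / Real.Gamma (m + b / 2 + 1)) := by
  have hG := Gamma_natCast_add_add_one_pos hb m
  have hG' := Gamma_natCast_add_add_one_pos (b := b / 2) (by linarith) m
  have hΓ := Gamma_natCast_add_half_add_one_sq_le hb m
  have split_succ : (1 / p) ^ (m + b / 2 + 1) = (1 / p) ^ (m + b / 2) / p := by
    rw [Real.rpow_add_one (by positivity), mul_one_div]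
  have split_quotient :
      w ^ (-(b / 2)) * (w / p) ^ (m + b / 2) = w ^ m * (1 / p) ^ (m + b / 2) := by
    rw [div_eq_mul_one_div w, Real.mul_rpow hw.le (by positivity), ← mul_assoc,
      ← Real.rpow_add hw, neg_add_cancel_comm_assoc, Real.rpow_natCast]
  calc _ = w ^ m * (1 / p) ^ (m + b / 2) / p *
        (Real.Gamma (m + b / 2 + 1) / (m.factorial * Real.Gamma (m + b + 1))) := by
        rw [split_succ]; ring
    _ ≤ w ^ m * (1 / p) ^ (m + b / 2) / p * (1 / Real.Gamma (m + b / 2 + 1)) := by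
        gcongr ?_ * ?_
        rwa [div_le_div_iff₀ (by positivity) hG', one_mul, ← sq]
    _ = _ := by rw [← split_quotient]; ring

theorem integral_rpow_mul_exp_mul_besselSeries_le {p w : ℝ} (hb : 0 ≤ b) (hp : 0 < p)
    (hw : 0 < w) :
    ∫ y in Set.Ioi 0, y ^ (b / 2) * Real.exp (-(p * y)) * besselSeries b (w * y) ≤
      w ^ (-(b / 2)) / p * Real.exp (w / p) := by
  set F : ℕ → ℝ := fun m => w ^ m / (m.factorial * Real.Gamma (m + b + 1)) *
    ((1 / p) ^ (m + b / 2 + 1) * Real.Gamma (m + b / 2 + 1))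
  have F_nonneg (m : ℕ) : 0 ≤ F m := by
    have := Gamma_natCast_add_add_one_pos (b := b) (by linarith) m
    have := Gamma_natCast_add_add_one_pos (b := b / 2) (by linarith) m
    positivity
  have partial_sum_le (N : ℕ) :
      ∑ m ∈ Finset.range N, F m ≤ w ^ (-(b / 2)) / p * Real.exp (w / p) := by
    calc ∑ m ∈ Finset.range N, F m
        ≤ w ^ (-(b / 2)) / p *
          ∑ m ∈ Finset.range N, (w / p) ^ (m + b / 2) / Real.Gamma (m + b / 2 + 1) := by
          rw [Finset.mul_sum]
          exact Finset.sum_le_sum fun m _ =>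
            laplace_besselSeries_term_le (by linarith) hp hw m
      _ ≤ _ := by
          gcongr
          exact sum_rpow_div_Gamma_le_exp (by positivity) (by positivity) N
  have summable_F : Summable F := summable_of_sum_range_le F_nonneg partial_sum_le
  rw [integral_rpow_mul_exp_mul_besselSeries (by linarith) (by linarith) hp hw.le
    summable_F.hasSum]
  exact summable_F.tsum_le_of_sum_range_le partial_sum_le

theorem integral_rpow_add_natCast_mul_exp_mul_besselSeries {p w : ℝ} (hb : -1 < b) (hp : 0 < p)
    (hw : 0 ≤ w) (k : ℕ) :
    ∫ y in Set.Ioi 0, y ^ (b + k) * Real.exp (-(p * y)) * besselSeries b (w * y) =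
      (1 / p) ^ (b + k + 1) * (Real.exp (w / p) * ∑ i ∈ Finset.range (k + 1),
        k.choose i * (w / p) ^ i * (Real.Gamma (k + b + 1) / Real.Gamma (i + b + 1))) := by
  refine integral_rpow_mul_exp_mul_besselSeries hb
    (by linarith [(Nat.cast_nonneg k : (0 : ℝ) ≤ k)]) hp hw
    (((hasSum_pow_div_factorial_mul_Gamma_ratio hb k (w / p)).mul_left
      ((1 / p) ^ (b + k + 1))).congr_fun fun m => ?_)
  have split_exponent :
      (1 / p) ^ ((m : ℝ) + (b + k) + 1) = (1 / p) ^ m * (1 / p) ^ (b + k + 1) := by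
    rw [← Real.rpow_natCast (1 / p) m, ← Real.rpow_add (by positivity), add_assoc (m : ℝ)]
  rw [split_exponent, show (m : ℝ) + (b + k) + 1 = m + k + b + 1 by ring,
    div_eq_mul_one_div w, mul_pow]
  ring

end besselSeries

/-! ### One-dimensional Laguerre functions -/

/-- The monomial of degree `k` times the square root `x^(b/2) e^(-x/2)` of the Laguerre weight of
order `b`; the Laguerre functions of order `b` are linear combinations of these. -/
noncomputable def laguerreMonomial (b : ℝ) (k : ℕ) (x : ℝ) : ℝ :=
  x ^ k * (x ^ (b / 2) * Real.exp (-x / 2))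

/-- The coefficient of `laguerreMonomial b k` in the Laguerre function of degree `n`. -/
noncomputable def laguerreCoeff (b : ℝ) (n k : ℕ) : ℝ :=
  Real.sqrt (Real.Gamma (n + 1) / Real.Gamma (n + b + 1)) *
    (Real.Gamma (n + b + 1) / Real.Gamma (k + b + 1) *
      ((-1) ^ k / ((k.factorial : ℝ) * ((n - k).factorial : ℝ))))

section laguerreFun

variable {b : ℝ}

theorem laguerreFun_eq_sum (b : ℝ) (n : ℕ) (x : ℝ) :
    laguerreFun b n x =
      ∑ k ∈ Finset.range (n + 1), laguerreCoeff b n k * laguerreMonomial b k x := by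
  simp only [laguerreFun, laguerrePoly, Finset.mul_sum, Finset.sum_mul, laguerreCoeff,
    laguerreMonomial]
  refine Finset.sum_congr rfl fun k _ => ?_
  rw [neg_pow]
  ring

theorem laguerreCoeff_eq_choose (hb : -1 < b) {n k : ℕ} (hk : k ≤ n) :
    laguerreCoeff b n k = Real.sqrt (Real.Gamma (n + 1) / Real.Gamma (n + b + 1)) *
      (Real.Gamma (n + b + 1) / n.factorial) *
        ((-1) ^ k * n.choose k / Real.Gamma (k + b + 1)) := by
  have := Gamma_natCast_add_add_one_pos hb k
  rw [Nat.cast_choose ℝ hk, laguerreCoeff]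
  field_simp

theorem laguerreCoeff_self (hb : -1 < b) (n : ℕ) :
    laguerreCoeff b n n =
      Real.sqrt (Real.Gamma (n + 1) / Real.Gamma (n + b + 1)) * ((-1) ^ n / n.factorial) := by
  have := Gamma_natCast_add_add_one_pos hb n
  rw [laguerreCoeff_eq_choose hb le_rfl, Nat.choose_self]
  field_simp
  simp

theorem laguerreCoeff_self_ne_zero (hb : -1 < b) (n : ℕ) : laguerreCoeff b n n ≠ 0 := by
  have hG := Gamma_natCast_add_add_one_pos hb n
  have : 0 < Real.Gamma (n + 1) := Real.Gamma_pos_of_pos n.cast_add_one_pos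
  rw [laguerreCoeff_self hb]
  exact mul_ne_zero (Real.sqrt_pos.2 (by positivity)).ne'
    (div_ne_zero (pow_ne_zero _ (by norm_num)) (by positivity))

theorem laguerreMonomial_eq_rpow (k : ℕ) {x : ℝ} (hx : 0 < x) :
    laguerreMonomial b k x = x ^ (k + b / 2) * Real.exp (-(1 / 2 * x)) := by
  rw [laguerreMonomial, Real.rpow_add hx, Real.rpow_natCast]
  ring_nf

theorem laguerreMonomial_mul (j k : ℕ) {x : ℝ} (hx : 0 < x) :
    laguerreMonomial b j x * laguerreMonomial b k x = x ^ (k + j + b) * Real.exp (-(1 * x)) := by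
  rw [laguerreMonomial_eq_rpow j hx, laguerreMonomial_eq_rpow k hx, mul_mul_mul_comm,
    ← Real.rpow_add hx, ← Real.exp_add]
  ring_nf

theorem measurable_laguerreMonomial (b : ℝ) (k : ℕ) : Measurable (laguerreMonomial b k) := by
  unfold laguerreMonomial
  fun_prop

theorem measurable_laguerreFun (b : ℝ) (n : ℕ) : Measurable (laguerreFun b n) := by
  rw [funext (laguerreFun_eq_sum b n)]
  exact Finset.measurable_sum _ fun k _ => (measurable_laguerreMonomial b k).const_mul _

theorem integrableOn_laguerreMonomial (hb : -1 < b) (k : ℕ) :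
    IntegrableOn (laguerreMonomial b k) (Set.Ioi 0) := by
  have := integrableOn_rpow_mul_exp_neg_mul (c := k + b / 2) (p := 1 / 2)
    (by linarith [(Nat.cast_nonneg k : (0 : ℝ) ≤ k)]) one_half_pos
  exact this.congr_fun (fun x hx => (laguerreMonomial_eq_rpow k hx).symm) measurableSet_Ioi

theorem integrableOn_laguerreMonomial_mul (hb : -1 < b) (j k : ℕ) :
    IntegrableOn (fun x => laguerreMonomial b j x * laguerreMonomial b k x) (Set.Ioi 0) := by
  have := integrableOn_rpow_mul_exp_neg_mul (c := k + j + b) (p := 1)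
    (by linarith [(Nat.cast_nonneg j : (0 : ℝ) ≤ j), (Nat.cast_nonneg k : (0 : ℝ) ≤ k)]) one_pos
  exact this.congr_fun (fun x hx => (laguerreMonomial_mul j k hx).symm) measurableSet_Ioi

theorem integral_laguerreMonomial_mul (hb : -1 < b) (j k : ℕ) :
    ∫ x in Set.Ioi 0, laguerreMonomial b j x * laguerreMonomial b k x =
      Real.Gamma (k + j + b + 1) := by
  have := Real.integral_rpow_mul_exp_neg_mul_Ioi (a := k + j + b + 1) (r := 1)
    (by linarith [(Nat.cast_nonneg j : (0 : ℝ) ≤ j), (Nat.cast_nonneg k : (0 : ℝ) ≤ k)]) one_pos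
  rw [add_sub_cancel_right, div_one, Real.one_rpow, one_mul] at this
  rw [← this]
  exact setIntegral_congr_fun measurableSet_Ioi fun x hx => laguerreMonomial_mul j k hx

theorem integrableOn_laguerreMonomial_mul_laguerreFun (hb : -1 < b) (j n : ℕ) :
    IntegrableOn (fun x => laguerreMonomial b j x * laguerreFun b n x) (Set.Ioi 0) := by
  simp only [laguerreFun_eq_sum, Finset.mul_sum, mul_left_comm _ (laguerreCoeff _ _ _)]
  exact integrable_finsetSum _ fun k _ => (integrableOn_laguerreMonomial_mul hb j k).const_mul _

theorem integral_laguerreMonomial_mul_laguerreFun (hb : -1 < b) {j n : ℕ} (hj : j ≤ n) :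
    ∫ x in Set.Ioi 0, laguerreMonomial b j x * laguerreFun b n x =
      if j = n then Real.sqrt (Real.Gamma (n + 1) / Real.Gamma (n + b + 1)) *
        ((-1) ^ n * Real.Gamma (n + b + 1)) else 0 := by
  simp only [laguerreFun_eq_sum, Finset.mul_sum, mul_left_comm _ (laguerreCoeff _ _ _)]
  rw [integral_finsetSum _ fun k _ => (integrableOn_laguerreMonomial_mul hb j k).const_mul _]
  simp only [integral_const_mul, integral_laguerreMonomial_mul hb]
  have term_eq : ∀ k ∈ Finset.range (n + 1), laguerreCoeff b n k * Real.Gamma (k + j + b + 1) =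
      Real.sqrt (Real.Gamma (n + 1) / Real.Gamma (n + b + 1)) *
        (Real.Gamma (n + b + 1) / n.factorial) * ((-1) ^ k * (n.choose k : ℝ) *
          (Real.Gamma (k + j + b + 1) / Real.Gamma (k + b + 1))) := fun k hk => by
    rw [laguerreCoeff_eq_choose hb (Nat.lt_succ_iff.1 (Finset.mem_range.1 hk))]
    ring
  rw [Finset.sum_congr rfl term_eq, ← Finset.mul_sum,
    sum_neg_one_pow_mul_choose_mul_Gamma_ratio hb hj]
  split_ifs
  · field_simp
  · simp

theorem integral_laguerreMonomial_mul_laguerreFun_of_lt (hb : -1 < b) {j n : ℕ} (hj : j < n) :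
    ∫ x in Set.Ioi 0, laguerreMonomial b j x * laguerreFun b n x = 0 := by
  rw [integral_laguerreMonomial_mul_laguerreFun hb hj.le, if_neg hj.ne]

theorem laguerreFun_mul_eq_sum (b : ℝ) (m : ℕ) (f : ℝ → ℝ) (x : ℝ) :
    laguerreFun b m x * f x =
      ∑ k ∈ Finset.range (m + 1), laguerreCoeff b m k * (laguerreMonomial b k x * f x) := by
  rw [laguerreFun_eq_sum, Finset.sum_mul]
  simp only [mul_assoc]

theorem integrableOn_laguerreFun_mul (hb : -1 < b) (m n : ℕ) :
    IntegrableOn (fun x => laguerreFun b m x * laguerreFun b n x) (Set.Ioi 0) := by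
  simp only [laguerreFun_mul_eq_sum b m]
  exact integrable_finsetSum _ fun k _ =>
    (integrableOn_laguerreMonomial_mul_laguerreFun hb k n).const_mul _

theorem integral_laguerreFun_mul_of_le (hb : -1 < b) {m n : ℕ} (hmn : m ≤ n) :
    ∫ x in Set.Ioi 0, laguerreFun b m x * laguerreFun b n x = if m = n then 1 else 0 := by
  simp only [laguerreFun_mul_eq_sum b m]
  rw [integral_finsetSum _ fun k _ =>
    (integrableOn_laguerreMonomial_mul_laguerreFun hb k n).const_mul _]
  simp only [integral_const_mul]
  rw [Finset.sum_range_succ, Finset.sum_eq_zero fun k hk => by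
    rw [integral_laguerreMonomial_mul_laguerreFun_of_lt hb
      ((Finset.mem_range.1 hk).trans_le hmn), mul_zero], zero_add,
    integral_laguerreMonomial_mul_laguerreFun hb hmn]
  rcases eq_or_ne m n with rfl | hne
  · have hG := Gamma_natCast_add_add_one_pos hb m
    have sign : ((-1 : ℝ) ^ m) * (-1) ^ m = 1 := by rw [← mul_pow]; simp
    have sq_sqrt := Real.mul_self_sqrt (x := Real.Gamma (m + 1) / Real.Gamma (m + b + 1))
      (div_nonneg (Real.Gamma_pos_of_pos m.cast_add_one_pos).le hG.le)
    rw [if_pos rfl, if_pos rfl, laguerreCoeff_self hb, mul_mul_mul_comm, sq_sqrt,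
      Real.Gamma_nat_eq_factorial]
    calc _ = ((-1 : ℝ) ^ m) * (-1) ^ m := by field_simp
      _ = 1 := sign
  · rw [if_neg hne, if_neg hne, mul_zero]

theorem integral_laguerreFun_mul (hb : -1 < b) (m n : ℕ) :
    ∫ x in Set.Ioi 0, laguerreFun b m x * laguerreFun b n x = if m = n then 1 else 0 := by
  rcases le_total m n with h | h
  · exact integral_laguerreFun_mul_of_le hb h
  · simp only [mul_comm (laguerreFun b m _), integral_laguerreFun_mul_of_le hb h, eq_comm]

theorem laguerreMonomial_mem_span_range_laguerreFun (hb : -1 < b) (n : ℕ) :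
    laguerreMonomial b n ∈ Submodule.span ℝ (Set.range (laguerreFun b)) := by
  induction n using Nat.strong_induction_on with
  | _ n ih =>
    have split_last : laguerreFun b n =
        ∑ k ∈ Finset.range n, laguerreCoeff b n k • laguerreMonomial b k +
          laguerreCoeff b n n • laguerreMonomial b n := by
      funext x
      rw [laguerreFun_eq_sum, Finset.sum_range_succ]
      simp
    have solve_last : laguerreMonomial b n = (laguerreCoeff b n n)⁻¹ • (laguerreFun b n -
        ∑ k ∈ Finset.range n, laguerreCoeff b n k • laguerreMonomial b k) := by
      rw [split_last, add_sub_cancel_left, inv_smul_smul₀ (laguerreCoeff_self_ne_zero hb n)]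
    rw [solve_last]
    exact Submodule.smul_mem _ _ (Submodule.sub_mem _ (Submodule.subset_span ⟨n, rfl⟩)
      (Submodule.sum_mem _ fun k hk => Submodule.smul_mem _ _ (ih k (Finset.mem_range.1 hk))))

end laguerreFun

/-! ### The Hille–Hardy formula -/

/-- The closed form of the heat kernel of the one-dimensional Laguerre functions of order `b` given
by the Hille–Hardy formula, with `r = exp (-t)` in place of the time `t`. -/
noncomputable def hilleHardyKernel (b r x y : ℝ) : ℝ :=
  r ^ ((b + 1) / 2) * (1 - r) ^ (-(b + 1)) *
    (x ^ (b / 2) * Real.exp (-((1 + r) / (2 * (1 - r)) * x))) *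
    (y ^ (b / 2) * Real.exp (-((1 + r) / (2 * (1 - r)) * y))) *
    besselSeries b (r / (1 - r) ^ 2 * x * y)

section hilleHardyKernel

variable {b r x : ℝ}

theorem hilleHardyKernel_comm (b r x y : ℝ) :
    hilleHardyKernel b r x y = hilleHardyKernel b r y x := by
  rw [hilleHardyKernel, hilleHardyKernel, mul_right_comm _ x y]
  ring

theorem hilleHardyKernel_nonneg (hb : -1 < b) (hr : 0 ≤ r) (hr1 : r ≤ 1) {y : ℝ} (hx : 0 ≤ x)
    (hy : 0 ≤ y) : 0 ≤ hilleHardyKernel b r x y := by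
  have := besselSeries_nonneg (z := r / (1 - r) ^ 2 * x * y) hb (by positivity)
  have := sub_nonneg.2 hr1
  rw [hilleHardyKernel]
  positivity

theorem measurable_hilleHardyKernel (hb : 0 ≤ b) (r : ℝ) :
    Measurable fun p : ℝ × ℝ => hilleHardyKernel b r p.1 p.2 := by
  unfold hilleHardyKernel
  exact Measurable.mul (by fun_prop) ((measurable_besselSeries hb).comp (by fun_prop))

theorem exists_hilleHardyKernel_le (hb : 0 ≤ b) (hr : 0 ≤ r) (hr1 : r < 1) :
    ∃ C δ : ℝ, 0 ≤ C ∧ 0 < δ ∧ ∀ x y, 0 ≤ x → 0 ≤ y → hilleHardyKernel b r x y ≤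
      C * (x ^ (b / 2) * Real.exp (-(δ * x))) * (y ^ (b / 2) * Real.exp (-(δ * y))) := by
  have h1r : 0 < 1 - r := sub_pos.2 hr1
  have sqrt_lt_one : √r < 1 := by rw [Real.sqrt_lt' one_pos]; simpa using hr1
  have sqrt_mul_self : √r * √r = r := Real.mul_self_sqrt hr
  set A := (1 + r) / (2 * (1 - r)) with hA
  set κ := √r / (1 - r) with hκ
  have A_sub_κ : A - κ = (1 - √r) ^ 2 / (2 * (1 - r)) := by
    rw [hA, hκ]
    field_simp
    linear_combination -sqrt_mul_self
  have exp_split (u : ℝ) :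
      Real.exp (-((A - κ) * u)) = Real.exp (-(A * u)) * Real.exp (κ * u) := by
    rw [← Real.exp_add]
    ring_nf
  refine ⟨r ^ ((b + 1) / 2) * (1 - r) ^ (-(b + 1)) / Real.Gamma (b + 1), A - κ, by positivity, ?_,
    fun x y hx hy => ?_⟩
  · have := sub_pos.2 sqrt_lt_one
    rw [A_sub_κ]
    positivity
  · have argument_eq : r / (1 - r) ^ 2 * x * y = (κ * x) * (κ * y) := by
      rw [hκ, mul_mul_mul_comm, div_mul_div_comm, sqrt_mul_self, ← sq, mul_assoc]
    have bessel_le := besselSeries_mul_le (b := b) (u := κ * x) (v := κ * y) hb (by positivity)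
      (by positivity)
    rw [hilleHardyKernel, argument_eq]
    calc _ ≤ r ^ ((b + 1) / 2) * (1 - r) ^ (-(b + 1)) *
          (x ^ (b / 2) * Real.exp (-(A * x))) * (y ^ (b / 2) * Real.exp (-(A * y))) *
          (Real.exp (κ * x) * Real.exp (κ * y) / Real.Gamma (b + 1)) := by gcongr
      _ = _ := by
        rw [exp_split, exp_split]
        ring

theorem hilleHardyKernel_prefactor_eq (hr : 0 < r) (hr1 : r < 1) (hx : 0 < x) :
    r ^ ((b + 1) / 2) * (1 - r) ^ (-(b + 1)) * x ^ (b / 2) * (r / (1 - r) ^ 2 * x) ^ (-(b / 2)) =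
      √r / (1 - r) := by
  have h1r : 0 < 1 - r := sub_pos.2 hr1
  have powers_of_sub : ((1 - r) ^ 2) ^ (-(b / 2)) = (1 - r) ^ (-b) := by
    rw [← Real.rpow_natCast, ← Real.rpow_mul h1r.le]
    congr 1
    push_cast
    ring
  have powers_of_r : r ^ ((b + 1) / 2) * r ^ (-(b / 2)) = √r := by
    rw [← Real.rpow_add hr, Real.sqrt_eq_rpow]
    ring_nf
  have cancel_sub : (1 - r) ^ (-(b + 1)) / (1 - r) ^ (-b) = (1 - r)⁻¹ := by
    rw [← Real.rpow_sub h1r, ← Real.rpow_neg_one]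
    ring_nf
  have cancel_x : x ^ (b / 2) * x ^ (-(b / 2)) = 1 := by
    rw [← Real.rpow_add hx, add_neg_cancel, Real.rpow_zero]
  rw [Real.mul_rpow (by positivity) hx.le, Real.div_rpow hr.le (by positivity), powers_of_sub]
  calc _ = (r ^ ((b + 1) / 2) * r ^ (-(b / 2))) * ((1 - r) ^ (-(b + 1)) / (1 - r) ^ (-b)) *
        (x ^ (b / 2) * x ^ (-(b / 2))) := by ring
    _ = √r / (1 - r) := by rw [powers_of_r, cancel_sub, cancel_x, mul_one, div_eq_mul_inv]

theorem integral_hilleHardyKernel_le (hb : 0 ≤ b) (hr : 0 < r) (hr1 : r < 1) (hx : 0 < x) :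
    ∫ y in Set.Ioi 0, hilleHardyKernel b r x y ≤ 2 * √r / (1 + r) := by
  have h1r : 0 < 1 - r := sub_pos.2 hr1
  set A := (1 + r) / (2 * (1 - r)) with hA
  set w := r / (1 - r) ^ 2 * x with hw
  have w_div_A_le : w / A ≤ A * x := by
    have : r / (1 - r) ^ 2 ≤ A * A := by
      rw [hA, div_mul_div_comm, div_le_div_iff₀ (by positivity) (by positivity)]
      nlinarith [mul_nonneg (sq_nonneg (1 - r)) (sq_nonneg (1 - r))]
    rw [div_le_iff₀ (by positivity), hw]
    nlinarith
  have integral_eq : ∫ y in Set.Ioi 0, hilleHardyKernel b r x y =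
      r ^ ((b + 1) / 2) * (1 - r) ^ (-(b + 1)) * (x ^ (b / 2) * Real.exp (-(A * x))) *
        ∫ y in Set.Ioi 0, y ^ (b / 2) * Real.exp (-(A * y)) * besselSeries b (w * y) := by
    rw [← integral_const_mul]
    simp only [hilleHardyKernel, mul_assoc, ← hA, hw]
  rw [integral_eq]
  calc _ ≤ r ^ ((b + 1) / 2) * (1 - r) ^ (-(b + 1)) * (x ^ (b / 2) * Real.exp (-(A * x))) *
        (w ^ (-(b / 2)) / A * Real.exp (w / A)) := by
        gcongr
        exact integral_rpow_mul_exp_mul_besselSeries_le hb (by positivity) (by positivity)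
    _ = (r ^ ((b + 1) / 2) * (1 - r) ^ (-(b + 1)) * x ^ (b / 2) * w ^ (-(b / 2))) / A *
        Real.exp (w / A - A * x) := by
        rw [sub_eq_neg_add (w / A), Real.exp_add]
        ring
    _ = 2 * √r / (1 + r) * Real.exp (w / A - A * x) := by
        rw [hilleHardyKernel_prefactor_eq hr hr1 hx, hA]
        field_simp
    _ ≤ 2 * √r / (1 + r) :=
        mul_le_of_le_one_right (by positivity) (Real.exp_le_one_iff.2 (sub_nonpos.2 w_div_A_le))

theorem hilleHardyKernel_mul_laguerreMonomial (hr1 : r < 1) {y : ℝ} (hy : 0 < y) (k : ℕ) :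
    hilleHardyKernel b r x y * laguerreMonomial b k y =
      r ^ ((b + 1) / 2) * (1 - r) ^ (-(b + 1)) *
        (x ^ (b / 2) * Real.exp (-((1 + r) / (2 * (1 - r)) * x))) *
        (y ^ (b + k) * Real.exp (-(1 / (1 - r) * y)) *
          besselSeries b (r / (1 - r) ^ 2 * x * y)) := by
  have h1r : 0 < 1 - r := sub_pos.2 hr1
  have rate_eq : 1 / (1 - r) = (1 + r) / (2 * (1 - r)) + 1 / 2 := by
    field_simp
    ring
  have power_eq : y ^ (b + k) = y ^ (b / 2) * y ^ (k + b / 2) := by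
    rw [← Real.rpow_add hy]
    ring_nf
  rw [hilleHardyKernel, laguerreMonomial_eq_rpow k hy, rate_eq, power_eq,
    add_mul _ _ y, neg_add (_ * y), Real.exp_add]
  ring

theorem integral_hilleHardyKernel_mul_laguerreMonomial (hb : -1 < b) (hr : 0 ≤ r) (hr1 : r < 1)
    (hx : 0 ≤ x) (k : ℕ) :
    ∫ y in Set.Ioi 0, hilleHardyKernel b r x y * laguerreMonomial b k y =
      r ^ ((b + 1) / 2) * ∑ i ∈ Finset.range (k + 1), k.choose i * r ^ i * (1 - r) ^ (k - i) *
        (Real.Gamma (k + b + 1) / Real.Gamma (i + b + 1)) * laguerreMonomial b i x := by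
  have h1r : 0 < 1 - r := sub_pos.2 hr1
  have argument_eq : r / (1 - r) ^ 2 * x / (1 / (1 - r)) = r * x / (1 - r) := by field_simp
  have exp_eq : Real.exp (-((1 + r) / (2 * (1 - r)) * x)) * Real.exp (r * x / (1 - r)) =
      Real.exp (-x / 2) := by
    rw [← Real.exp_add]
    congr 1
    field_simp
    ring
  have power_eq : (1 - r) ^ (-(b + 1)) * (1 - r) ^ (b + k + 1) = (1 - r) ^ k := by
    rw [← Real.rpow_add h1r, ← Real.rpow_natCast]
    ring_nf
  rw [setIntegral_congr_fun measurableSet_Ioi fun y hy =>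
      hilleHardyKernel_mul_laguerreMonomial hr1 hy k, integral_const_mul,
    integral_rpow_add_natCast_mul_exp_mul_besselSeries hb (by positivity) (by positivity),
    argument_eq, one_div_one_div]
  calc _ = r ^ ((b + 1) / 2) * (((1 - r) ^ (-(b + 1)) * (1 - r) ^ (b + k + 1)) *
        (x ^ (b / 2) * (Real.exp (-((1 + r) / (2 * (1 - r)) * x)) *
          Real.exp (r * x / (1 - r)))) * ∑ i ∈ Finset.range (k + 1),
            k.choose i * (r * x / (1 - r)) ^ i *
              (Real.Gamma (k + b + 1) / Real.Gamma (i + b + 1))) := by ring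
    _ = _ := by
      rw [exp_eq, power_eq, Finset.mul_sum]
      congr 1
      refine Finset.sum_congr rfl fun i hi => ?_
      rw [laguerreMonomial, div_pow, mul_pow,
        ← Nat.sub_add_cancel (Nat.lt_succ_iff.1 (Finset.mem_range.1 hi)), pow_add,
        Nat.add_sub_cancel]
      field_simp

theorem integrableOn_hilleHardyKernel_mul_laguerreMonomial (hb : 0 ≤ b) (hr : 0 ≤ r) (hr1 : r < 1)
    (hx : 0 ≤ x) (k : ℕ) :
    IntegrableOn (fun y => hilleHardyKernel b r x y * laguerreMonomial b k y) (Set.Ioi 0) := by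
  obtain ⟨C, δ, hC, hδ, kernel_le⟩ := exists_hilleHardyKernel_le hb hr hr1
  refine (integrableOn_laguerreMonomial (by linarith) k).bdd_mul
    (c := C * (x ^ (b / 2) * Real.exp (-(δ * x))) * ((b / 2 + 1) / δ) ^ (b / 2))
    ((measurable_hilleHardyKernel hb r).comp measurable_prodMk_left).aestronglyMeasurable ?_
  filter_upwards [ae_restrict_mem measurableSet_Ioi] with y (hy : 0 < y)
  rw [Real.norm_of_nonneg (hilleHardyKernel_nonneg (by linarith) hr hr1.le hx hy.le)]
  refine (kernel_le x y hx hy.le).trans ?_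
  gcongr
  exact rpow_mul_exp_neg_mul_le (by positivity) hδ hy.le

/-- The coefficients of the Laguerre functions diagonalize the triangular matrix with entries
`C(k,i) r^i (1-r)^(k-i) Γ(k+b+1) / Γ(i+b+1)`. -/
theorem sum_laguerreCoeff_mul_sum_choose (hb : -1 < b) (r : ℝ) (n : ℕ) (u : ℕ → ℝ) :
    ∑ k ∈ Finset.range (n + 1), laguerreCoeff b n k *
        ∑ i ∈ Finset.range (k + 1), k.choose i * r ^ i * (1 - r) ^ (k - i) *
          (Real.Gamma (k + b + 1) / Real.Gamma (i + b + 1)) * u i =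
      r ^ n * ∑ i ∈ Finset.range (n + 1), laguerreCoeff b n i * u i := by
  have extend_range : ∀ k ∈ Finset.range (n + 1), ∑ i ∈ Finset.range (k + 1),
        (k.choose i : ℝ) * r ^ i * (1 - r) ^ (k - i) *
          (Real.Gamma (k + b + 1) / Real.Gamma (i + b + 1)) * u i =
      ∑ i ∈ Finset.range (n + 1), (k.choose i : ℝ) * r ^ i * (1 - r) ^ (k - i) *
          (Real.Gamma (k + b + 1) / Real.Gamma (i + b + 1)) * u i := by
    intro k hk
    refine Finset.sum_subset (Finset.range_subset_range.2 (Finset.mem_range.1 hk)) fun i _ hi => ?_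
    rw [Nat.choose_eq_zero_of_lt (by rw [Finset.mem_range] at hi; omega)]
    simp
  rw [Finset.sum_congr rfl fun k hk => by rw [extend_range k hk]]
  simp only [Finset.mul_sum]
  rw [Finset.sum_comm]
  refine Finset.sum_congr rfl fun i hi => ?_
  have hin : i ≤ n := Nat.lt_succ_iff.1 (Finset.mem_range.1 hi)
  have separate : ∀ k ∈ Finset.range (n + 1), laguerreCoeff b n k *
        (k.choose i * r ^ i * (1 - r) ^ (k - i) *
          (Real.Gamma (k + b + 1) / Real.Gamma (i + b + 1)) * u i) =
      Real.sqrt (Real.Gamma (n + 1) / Real.Gamma (n + b + 1)) *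
          (Real.Gamma (n + b + 1) / n.factorial) / Real.Gamma (i + b + 1) * r ^ i * u i *
        (n.choose k * k.choose i * (-1) ^ k * (1 - r) ^ (k - i)) := by
    intro k hk
    have := Gamma_natCast_add_add_one_pos hb k
    rw [laguerreCoeff_eq_choose hb (Nat.lt_succ_iff.1 (Finset.mem_range.1 hk))]
    field_simp
  rw [Finset.sum_congr rfl separate, ← Finset.mul_sum,
    sum_choose_mul_choose_mul_neg_one_pow hin, sub_sub_cancel, laguerreCoeff_eq_choose hb hin,
    ← Nat.sub_add_cancel hin, pow_add, Nat.add_sub_cancel]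
  ring

theorem integral_hilleHardyKernel_mul_laguerreFun (hb : 0 ≤ b) (hr : 0 ≤ r) (hr1 : r < 1)
    (hx : 0 ≤ x) (n : ℕ) :
    ∫ y in Set.Ioi 0, hilleHardyKernel b r x y * laguerreFun b n y =
      r ^ ((b + 1) / 2) * r ^ n * laguerreFun b n x := by
  have hb' : -1 < b := by linarith
  have expand (y : ℝ) : hilleHardyKernel b r x y * laguerreFun b n y =
      ∑ k ∈ Finset.range (n + 1),
        laguerreCoeff b n k * (hilleHardyKernel b r x y * laguerreMonomial b k y) := by
    rw [laguerreFun_eq_sum, Finset.mul_sum]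
    exact Finset.sum_congr rfl fun k _ => mul_left_comm _ _ _
  simp only [expand]
  rw [integral_finsetSum _ fun k _ =>
    (integrableOn_hilleHardyKernel_mul_laguerreMonomial hb hr hr1 hx k).const_mul _]
  simp only [integral_const_mul, integral_hilleHardyKernel_mul_laguerreMonomial hb' hr hr1 hx]
  rw [laguerreFun_eq_sum, mul_assoc (r ^ _), ← sum_laguerreCoeff_mul_sum_choose hb', Finset.mul_sum]
  exact Finset.sum_congr rfl fun k _ => mul_left_comm _ _ _

end hilleHardyKernel

/-! ### Determinacy of the moment problem under exponential integrability -/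

section complexMGF

open ProbabilityTheory

variable {Ω Ω' : Type*} [MeasurableSpace Ω] [MeasurableSpace Ω'] {μ : Measure Ω} {ν : Measure Ω'}
  {X : Ω → ℝ} {Y : Ω' → ℝ}

theorem complexMGF_eq_of_forall_integral_pow_eq (hX : 0 ∈ interior (integrableExpSet X μ))
    (hY : 0 ∈ interior (integrableExpSet Y ν)) (h : ∀ n : ℕ, μ[X ^ n] = ν[Y ^ n]) {z : ℂ}
    (hzX : z.re ∈ interior (integrableExpSet X μ)) (hzY : z.re ∈ interior (integrableExpSet Y ν)) :
    complexMGF X μ z = complexMGF Y ν z := by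
  set strip : Set ℂ :=
    Complex.re ⁻¹' (interior (integrableExpSet X μ) ∩ interior (integrableExpSet Y ν))
  have preconnected : IsPreconnected strip :=
    ((convex_integrableExpSet.interior.inter convex_integrableExpSet.interior).linear_preimage
      Complex.reLm).isPreconnected
  have analytic_X : AnalyticOnNhd ℂ (complexMGF X μ) strip :=
    analyticOnNhd_complexMGF.mono fun _ hz => hz.1
  have analytic_Y : AnalyticOnNhd ℂ (complexMGF Y ν) strip :=
    analyticOnNhd_complexMGF.mono fun _ hz => hz.2
  have derivatives_eq (n : ℕ) :
      iteratedDeriv n (complexMGF X μ) 0 = iteratedDeriv n (complexMGF Y ν) 0 := by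
    rw [iteratedDeriv_complexMGF (by simpa using hX), iteratedDeriv_complexMGF (by simpa using hY)]
    simp only [zero_mul, Complex.exp_zero, mul_one, ← Complex.ofReal_pow, integral_complex_ofReal]
    exact congrArg _ (h n)
  have zero_mem : (0 : ℂ) ∈ strip := ⟨hX, hY⟩
  have series_X := (analytic_X 0 zero_mem).hasFPowerSeriesAt
  have series_Y := (analytic_Y 0 zero_mem).hasFPowerSeriesAt
  simp only [derivatives_eq] at series_X
  have eventually_eq : complexMGF X μ =ᶠ[𝓝 0] complexMGF Y ν := by
    filter_upwards [series_X.eventually_hasSum_sub, series_Y.eventually_hasSum_sub] with w hX hY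
    exact hX.unique hY
  exact analytic_X.eqOn_of_preconnected_of_eventuallyEq analytic_Y preconnected zero_mem
    eventually_eq ⟨hzX, hzY⟩

end complexMGF

section Moments

variable {ι : Type*} [Fintype ι] {μ ν : Measure (ι → ℝ)} {δ : ℝ}

theorem norm_le_sum_abs (x : ι → ℝ) : ‖x‖ ≤ ∑ i, |x i| :=
  (pi_norm_le_iff_of_nonneg (by positivity)).2 fun i =>
    Finset.single_le_sum (f := fun i => |x i|) (fun i _ => abs_nonneg _) (Finset.mem_univ i)

theorem abs_prod_pow_le_mul_exp (hδ : 0 < δ) (n : ι → ℕ) (x : ι → ℝ) :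
    |∏ i, x i ^ n i| ≤ (∏ i, (n i).factorial / δ ^ n i) * Real.exp (δ * ∑ i, |x i|) := by
  rw [Finset.abs_prod, Finset.mul_sum, Real.exp_sum, ← Finset.prod_mul_distrib]
  refine Finset.prod_le_prod (fun i _ => abs_nonneg _) fun i _ => ?_
  have := Real.pow_div_factorial_le_exp (δ * |x i|) (by positivity) (n i)
  rw [mul_pow, div_le_iff₀ (by positivity)] at this
  rw [abs_pow, div_mul_eq_mul_div, le_div_iff₀ (by positivity)]
  linarith

theorem integrable_prod_pow (hδ : 0 < δ)
    (hμ : Integrable (fun x : ι → ℝ => Real.exp (δ * ∑ i, |x i|)) μ) (n : ι → ℕ) :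
    Integrable (fun x : ι → ℝ => ∏ i, x i ^ n i) μ :=
  (hμ.const_mul _).mono' (by fun_prop : Measurable _).aestronglyMeasurable
    (ae_of_all _ fun x => abs_prod_pow_le_mul_exp hδ n x)

theorem zero_mem_interior_integrableExpSet (hδ : 0 < δ)
    (hμ : Integrable (fun x : ι → ℝ => Real.exp (δ * ∑ i, |x i|)) μ)
    (L : StrongDual ℝ (ι → ℝ)) :
    0 ∈ interior (ProbabilityTheory.integrableExpSet L μ) := by
  set ε := δ / (‖L‖ + 1) with hε
  have ε_pos : 0 < ε := by positivity
  refine mem_interior.2 ⟨Set.Ioo (-ε) ε, fun t ht => ?_, isOpen_Ioo, by simp [ε_pos]⟩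
  refine hμ.mono' (by fun_prop) (ae_of_all _ fun x => ?_)
  rw [Real.norm_eq_abs, Real.abs_exp, Real.exp_le_exp]
  calc t * L x ≤ |t| * ‖L x‖ := by
        rw [Real.norm_eq_abs, ← abs_mul]
        exact le_abs_self _
    _ ≤ ε * ((‖L‖ + 1) * ∑ i, |x i|) := by
        gcongr
        · exact (abs_lt.2 ht).le
        · exact (L.le_opNorm x).trans
            (mul_le_mul (by linarith) (norm_le_sum_abs x) (norm_nonneg x) (by positivity))
    _ = δ * ∑ i, |x i| := by rw [hε]; field_simp

theorem integral_eval_eq_of_forall_integral_prod_pow_eq (hδ : 0 < δ)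
    (hμ : Integrable (fun x : ι → ℝ => Real.exp (δ * ∑ i, |x i|)) μ)
    (hν : Integrable (fun x : ι → ℝ => Real.exp (δ * ∑ i, |x i|)) ν)
    (h : ∀ n : ι → ℕ, ∫ x, ∏ i, x i ^ n i ∂μ = ∫ x, ∏ i, x i ^ n i ∂ν) (P : MvPolynomial ι ℝ) :
    ∫ x, P.eval x ∂μ = ∫ x, P.eval x ∂ν := by
  simp only [MvPolynomial.eval_eq']
  rw [integral_finsetSum _ fun (k : ι →₀ ℕ) _ => (integrable_prod_pow hδ hμ k).const_mul _,
    integral_finsetSum _ fun (k : ι →₀ ℕ) _ => (integrable_prod_pow hδ hν k).const_mul _]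
  simp only [integral_const_mul, h]

theorem measure_eq_of_forall_integral_prod_pow_eq (hδ : 0 < δ)
    (hμ : Integrable (fun x : ι → ℝ => Real.exp (δ * ∑ i, |x i|)) μ)
    (hν : Integrable (fun x : ι → ℝ => Real.exp (δ * ∑ i, |x i|)) ν)
    (h : ∀ n : ι → ℕ, ∫ x, ∏ i, x i ^ n i ∂μ = ∫ x, ∏ i, x i ^ n i ∂ν) : μ = ν := by
  classical
  have isFiniteMeasure (ρ : Measure (ι → ℝ))
      (hρ : Integrable (fun x : ι → ℝ => Real.exp (δ * ∑ i, |x i|)) ρ) : IsFiniteMeasure ρ :=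
    (integrable_const_iff_isFiniteMeasure one_ne_zero).1
      (by simpa using integrable_prod_pow hδ hρ 0 : Integrable (fun _ => (1 : ℝ)) ρ)
  have := isFiniteMeasure μ hμ
  have := isFiniteMeasure ν hν
  refine Measure.ext_of_charFunDual (funext fun L => ?_)
  have moments_eq (n : ℕ) : ∫ x, L x ^ n ∂μ = ∫ x, L x ^ n ∂ν := by
    have eval_eq (x : ι → ℝ) : L x ^ n = MvPolynomial.eval x
        ((∑ i, MvPolynomial.C (L fun j => if i = j then 1 else 0) * MvPolynomial.X i) ^ n) := by
      rw [map_pow, map_sum, ← L.coe_coe, (L : (ι → ℝ) →ₗ[ℝ] ℝ).pi_apply_eq_sum_univ x]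
      simp [mul_comm]
    simp only [eval_eq]
    exact integral_eval_eq_of_forall_integral_prod_pow_eq hδ hμ hν h _
  have mgf_eq : ProbabilityTheory.complexMGF L μ Complex.I =
      ProbabilityTheory.complexMGF L ν Complex.I :=
    complexMGF_eq_of_forall_integral_pow_eq (zero_mem_interior_integrableExpSet hδ hμ L)
      (zero_mem_interior_integrableExpSet hδ hν L) moments_eq
      (by simpa using zero_mem_interior_integrableExpSet hδ hμ L)
      (by simpa using zero_mem_interior_integrableExpSet hδ hν L)
  simpa only [charFunDual_apply, ProbabilityTheory.complexMGF, mul_comm Complex.I] using mgf_eq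

end Moments

section SignedDensity

variable {α : Type*} [MeasurableSpace α] {μ : Measure α} {h F : α → ℝ}

theorem integrable_withDensity_ofReal (hh : AEStronglyMeasurable h μ)
    (hF : AEStronglyMeasurable F μ) (hint : Integrable (fun x => F x * h x) μ) :
    Integrable F (μ.withDensity fun x => ENNReal.ofReal (h x)) := by
  rw [integrable_withDensity_iff_integrable_smul₀' hh.aemeasurable.ennreal_ofReal
    (ae_of_all _ fun x => ENNReal.ofReal_lt_top)]
  refine hint.mono (hh.aemeasurable.ennreal_ofReal.ennreal_toReal.aestronglyMeasurable.smul hF)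
    (ae_of_all _ fun x => ?_)
  rw [ENNReal.toReal_ofReal', norm_smul, norm_mul, mul_comm,
    Real.norm_of_nonneg (le_max_right _ _)]
  gcongr
  exact max_le (le_abs_self _) (abs_nonneg _)

theorem integral_withDensity_ofReal_sub (hh : AEStronglyMeasurable h μ)
    (hF : AEStronglyMeasurable F μ) (hint : Integrable (fun x => F x * h x) μ) :
    ∫ x, F x ∂(μ.withDensity fun x => ENNReal.ofReal (h x)) -
        ∫ x, F x ∂(μ.withDensity fun x => ENNReal.ofReal (-h x)) = ∫ x, F x * h x ∂μ := by
  have lt_top (g : α → ℝ) : ∀ᵐ x ∂μ, ENNReal.ofReal (g x) < ∞ :=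
    ae_of_all _ fun _ => ENNReal.ofReal_lt_top
  have integrable_pos := (integrable_withDensity_iff_integrable_smul₀'
    hh.aemeasurable.ennreal_ofReal (lt_top _)).1 (integrable_withDensity_ofReal hh hF hint)
  have integrable_neg : Integrable (fun x => (ENNReal.ofReal (-h x)).toReal • F x) μ :=
    (integrable_withDensity_iff_integrable_smul₀'
      hh.aemeasurable.neg.ennreal_ofReal (lt_top _)).1
      (integrable_withDensity_ofReal hh.neg hF (by simpa using hint.neg))
  rw [integral_withDensity_eq_integral_toReal_smul₀ hh.aemeasurable.ennreal_ofReal (lt_top _),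
    integral_withDensity_eq_integral_toReal_smul₀ (f := fun x => ENNReal.ofReal (-h x))
      hh.aemeasurable.neg.ennreal_ofReal (lt_top _),
    ← integral_sub integrable_pos integrable_neg]
  refine integral_congr_ae (ae_of_all _ fun x => ?_)
  simp only [ENNReal.toReal_ofReal', smul_eq_mul]
  rw [← sub_mul, max_zero_sub_max_neg_zero_eq_self, mul_comm]

theorem ae_eq_zero_of_withDensity_ofReal_eq (hh : AEStronglyMeasurable h μ)
    [IsFiniteMeasure (μ.withDensity fun x => ENNReal.ofReal (h x))]
    (heq : (μ.withDensity fun x => ENNReal.ofReal (h x)) =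
      μ.withDensity fun x => ENNReal.ofReal (-h x)) : h =ᵐ[μ] 0 := by
  have lintegral_ne_top : ∫⁻ x, ENNReal.ofReal (h x) ∂μ ≠ ∞ := by
    simpa using measure_ne_top (μ.withDensity fun x => ENNReal.ofReal (h x)) Set.univ
  filter_upwards [(withDensity_eq_iff hh.aemeasurable.ennreal_ofReal
    hh.neg.aemeasurable.ennreal_ofReal lintegral_ne_top).1 heq] with x hx
  have max_eq : max (h x) 0 = max (-h x) 0 := by
    simpa only [Pi.neg_apply, ENNReal.toReal_ofReal'] using congrArg ENNReal.toReal hx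
  rw [← max_zero_sub_max_neg_zero_eq_self (h x), max_eq, sub_self, Pi.zero_apply]

end SignedDensity

theorem ae_eq_zero_of_forall_integral_prod_pow_mul_eq_zero {ι : Type*} [Fintype ι]
    {μ : Measure (ι → ℝ)} {h : (ι → ℝ) → ℝ} {δ : ℝ} (hδ : 0 < δ) (hh : AEStronglyMeasurable h μ)
    (hint : Integrable (fun x => Real.exp (δ * ∑ i, |x i|) * h x) μ)
    (hmom : ∀ n : ι → ℕ, ∫ x, (∏ i, x i ^ n i) * h x ∂μ = 0) : h =ᵐ[μ] 0 := by
  have integrable_moment (n : ι → ℕ) : Integrable (fun x => (∏ i, x i ^ n i) * h x) μ := by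
    refine (hint.norm.const_mul (∏ i, (n i).factorial / δ ^ n i)).mono'
      ((by fun_prop : Measurable _).aestronglyMeasurable.mul hh) (ae_of_all _ fun x => ?_)
    rw [norm_mul, norm_mul, Real.norm_of_nonneg (Real.exp_pos _).le, ← mul_assoc]
    gcongr
    exact abs_prod_pow_le_mul_exp hδ n x
  have integrable_one : Integrable (fun x => 1 * h x) μ := by
    simpa only [Pi.zero_apply, pow_zero, Finset.prod_const_one] using integrable_moment 0
  have : IsFiniteMeasure (μ.withDensity fun x => ENNReal.ofReal (h x)) :=
    (integrable_const_iff_isFiniteMeasure one_ne_zero).1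
      (integrable_withDensity_ofReal hh aestronglyMeasurable_const integrable_one)
  refine ae_eq_zero_of_withDensity_ofReal_eq hh
    (measure_eq_of_forall_integral_prod_pow_eq hδ
      (integrable_withDensity_ofReal hh (by fun_prop : Measurable _).aestronglyMeasurable hint)
      (integrable_withDensity_ofReal hh.neg (by fun_prop : Measurable _).aestronglyMeasurable
        (by simpa using hint.neg)) fun n => ?_)
  rw [← sub_eq_zero, integral_withDensity_ofReal_sub hh
    (by fun_prop : Measurable _).aestronglyMeasurable (integrable_moment n), hmom]

/-! ### Integral operators with positive kernels -/

theorem aestronglyMeasurable_of_mem_LOneAddLInfty {X 𝕜 : Type*} [MeasurableSpace X] [RCLike 𝕜]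
    {μ : Measure X} {f : X → 𝕜} (hf : f ∈ LOneAddLInfty 𝕜 μ) : AEStronglyMeasurable f μ := by
  obtain ⟨g, h, hg, hh, rfl⟩ := hf
  exact hg.1.add hh.1

theorem mem_LOneAddLInfty_of_memLp {X 𝕜 : Type*} [MeasurableSpace X] [RCLike 𝕜] {μ : Measure X}
    {p : ℝ≥0∞} (hp : 1 ≤ p) {f : X → 𝕜} (hf : MemLp f p μ) : f ∈ LOneAddLInfty 𝕜 μ := by
  rcases eq_or_ne p ∞ with rfl | p_ne_top
  · exact ⟨0, f, MemLp.zero, hf, (zero_add f).symm⟩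
  have one_le_toReal : 1 ≤ p.toReal := by
    rwa [← ENNReal.toReal_one, ENNReal.toReal_le_toReal ENNReal.one_ne_top p_ne_top]
  let large : Set X := {x | 1 < ‖f x‖}
  have large_measurable : NullMeasurableSet large μ :=
    nullMeasurableSet_lt aemeasurable_const hf.1.norm.aemeasurable
  refine ⟨large.indicator f, largeᶜ.indicator f, memLp_one_iff_integrable.2 ?_,
    memLp_top_of_bound (hf.1.indicator₀ large_measurable.compl) 1 (ae_of_all _ fun x => ?_),
    (Set.indicator_self_add_compl large f).symm⟩
  · refine (hf.integrable_norm_rpow (by positivity) p_ne_top).mono'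
      (hf.1.indicator₀ large_measurable) (ae_of_all _ fun x => ?_)
    by_cases hx : x ∈ large
    · rw [Set.indicator_of_mem hx]
      exact Real.self_le_rpow_of_one_le hx.le one_le_toReal
    · rw [Set.indicator_of_notMem hx, norm_zero]
      positivity
  · by_cases hx : x ∈ large
    · rw [Set.indicator_of_notMem (Set.notMem_compl_iff.2 hx), norm_zero]
      exact zero_le_one
    · rw [Set.indicator_of_mem (Set.mem_compl hx)]
      exact not_lt.1 hx

theorem memLp_two_of_memLp_one_of_memLp_top {X E : Type*} [MeasurableSpace X]
    [NormedAddCommGroup E] {μ : Measure X} {f : X → E} (hf_one : MemLp f 1 μ)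
    (hf_top : MemLp f ∞ μ) : MemLp f 2 μ := by
  rw [← memLp_norm_iff hf_one.1, memLp_two_iff_integrable_sq hf_one.1.norm,
    ← memLp_one_iff_integrable]
  simp only [sq]
  exact hf_one.norm.mul' (p := ∞) (q := 1) hf_top.norm

theorem lintegral_mul_rpow_le {X : Type*} [MeasurableSpace X] {μ : Measure X} {w g : X → ℝ≥0∞}
    (hw : AEMeasurable w μ) (hg : AEMeasurable g μ) {q : ℝ} (hq : 1 ≤ q) :
    (∫⁻ x, w x * g x ∂μ) ^ q ≤ (∫⁻ x, w x ∂μ) ^ (q - 1) * ∫⁻ x, w x * g x ^ q ∂μ := by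
  have q_pos : 0 < q := one_pos.trans_le hq
  have inv_le_one : q⁻¹ ≤ 1 := inv_le_one_of_one_le₀ hq
  have split (x : X) : w x * g x = w x ^ (1 - q⁻¹) * (w x * g x ^ q) ^ q⁻¹ := by
    rw [ENNReal.mul_rpow_of_nonneg _ _ (inv_nonneg.2 q_pos.le), ENNReal.rpow_rpow_inv q_pos.ne',
      ← mul_assoc, ← ENNReal.rpow_add_of_nonneg _ _ (sub_nonneg.2 inv_le_one)
        (inv_nonneg.2 q_pos.le), sub_add_cancel, ENNReal.rpow_one]
  calc (∫⁻ x, w x * g x ∂μ) ^ q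
      ≤ ((∫⁻ x, w x ∂μ) ^ (1 - q⁻¹) * (∫⁻ x, w x * g x ^ q ∂μ) ^ q⁻¹) ^ q := by
        gcongr
        simp only [split]
        exact ENNReal.lintegral_mul_norm_pow_le hw (hw.mul (hg.pow_const q))
          (sub_nonneg.2 inv_le_one) (inv_nonneg.2 q_pos.le) (sub_add_cancel 1 q⁻¹)
    _ = (∫⁻ x, w x ∂μ) ^ (q - 1) * ∫⁻ x, w x * g x ^ q ∂μ := by
        rw [ENNReal.mul_rpow_of_nonneg _ _ q_pos.le, ENNReal.rpow_inv_rpow q_pos.ne',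
          ← ENNReal.rpow_mul, sub_mul, one_mul, inv_mul_cancel₀ q_pos.ne']

/-- The integral operator with kernel `K`, on functions defined pointwise; it vanishes at the points
`x` for which `K x · f` is not integrable. -/
noncomputable def kernelOp {X Y 𝕜 : Type*} [MeasurableSpace Y] [RCLike 𝕜] (μ : Measure Y)
    (K : X → Y → ℝ) (f : Y → 𝕜) (x : X) : 𝕜 :=
  ∫ y, K x y • f y ∂μ

section KernelOp

variable {X Y 𝕜 : Type*} [MeasurableSpace Y] [RCLike 𝕜] {μ : Measure Y}

theorem kernelOp_congr (K : X → Y → ℝ) {f g : Y → 𝕜} (h : f =ᵐ[μ] g) :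
    kernelOp μ K f = kernelOp μ K g := by
  funext x
  refine integral_congr_ae ?_
  filter_upwards [h] with y hy
  rw [hy]

theorem kernelOp_smul (K : X → Y → ℝ) (c : 𝕜) (f : Y → 𝕜) :
    kernelOp μ K (c • f) = c • kernelOp μ K f := by
  funext x
  simp only [kernelOp, Pi.smul_apply, smul_comm _ c]
  exact integral_smul c _

theorem kernelOp_ofReal (K : X → Y → ℝ) (f : Y → ℝ) (x : X) :
    kernelOp μ K (fun y => (f y : 𝕜)) x = ((kernelOp μ K f x : ℝ) : 𝕜) := by
  simp only [kernelOp, ← integral_ofReal, RCLike.real_smul_eq_coe_mul, smul_eq_mul,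
    RCLike.ofReal_mul]

theorem kernelOp_conj (K : X → Y → ℝ) (f : Y → 𝕜) (x : X) :
    kernelOp μ K (fun y => starRingEnd 𝕜 (f y)) x = starRingEnd 𝕜 (kernelOp μ K f x) := by
  simp only [kernelOp, ← integral_conj, RCLike.real_smul_eq_coe_mul, map_mul, RCLike.conj_ofReal]

theorem kernelOp_nonneg {K : X → Y → ℝ} {x : X} (hK : ∀ y, 0 ≤ K x y) {f : Y → 𝕜}
    (hf : ∀ᵐ y ∂μ, 0 ≤ f y) : 0 ≤ kernelOp μ K f x := by
  have f_eq_ofReal : f =ᵐ[μ] fun y => (RCLike.re (f y) : 𝕜) := by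
    filter_upwards [hf] with y hy
    exact (RCLike.conj_eq_iff_re.1 (RCLike.conj_eq_iff_im.2 (RCLike.nonneg_iff.1 hy).2)).symm
  rw [kernelOp_congr K f_eq_ofReal, kernelOp_ofReal, RCLike.ofReal_nonneg]
  refine integral_nonneg_of_ae ?_
  filter_upwards [hf] with y hy
  exact mul_nonneg (hK y) (RCLike.nonneg_iff.1 hy).1

theorem enorm_kernelOp_le (K : X → Y → ℝ) (f : Y → 𝕜) (x : X) :
    ‖kernelOp μ K f x‖ₑ ≤ ∫⁻ y, ‖K x y‖ₑ * ‖f y‖ₑ ∂μ := by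
  simpa only [kernelOp, enorm_smul] using enorm_integral_le_lintegral_enorm fun y => K x y • f y

variable [MeasurableSpace X] {ν : Measure X}

theorem aestronglyMeasurable_kernelOp [SFinite μ] {K : X → Y → ℝ}
    (hK : Measurable fun p : X × Y => K p.1 p.2) {f : Y → 𝕜} (hf : AEStronglyMeasurable f μ) :
    AEStronglyMeasurable (kernelOp μ K f) ν :=
  AEStronglyMeasurable.integral_prod_right' (f := fun p : X × Y => K p.1 p.2 • f p.2)
    (hK.aestronglyMeasurable.smul hf.comp_snd)

theorem eLpNorm_top_kernelOp_le {K : X → Y → ℝ} (hK : ∀ x, Measurable (K x)) {M : ℝ≥0∞}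
    (hrow : ∀ᵐ x ∂ν, ∫⁻ y, ‖K x y‖ₑ ∂μ ≤ M) (f : Y → 𝕜) :
    eLpNorm (kernelOp μ K f) ∞ ν ≤ M * eLpNorm f ∞ μ := by
  simp only [eLpNorm_exponent_top]
  refine eLpNormEssSup_le_of_ae_enorm_bound ?_
  filter_upwards [hrow] with x hx
  calc ‖kernelOp μ K f x‖ₑ ≤ ∫⁻ y, ‖K x y‖ₑ * ‖f y‖ₑ ∂μ := enorm_kernelOp_le K f x
    _ ≤ ∫⁻ y, ‖K x y‖ₑ * eLpNormEssSup f μ ∂μ := by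
        refine lintegral_mono_ae ?_
        filter_upwards [enorm_ae_le_eLpNormEssSup f μ] with y hy
        gcongr
    _ ≤ M * eLpNormEssSup f μ := by
        rw [lintegral_mul_const _ (hK x).enorm]
        gcongr

theorem lintegral_enorm_kernelOp_rpow_le [SFinite ν] [SFinite μ] {K : X → Y → ℝ}
    (hK : Measurable fun p : X × Y => K p.1 p.2) {M : ℝ≥0∞}
    (hrow : ∀ᵐ x ∂ν, ∫⁻ y, ‖K x y‖ₑ ∂μ ≤ M) (hcol : ∀ᵐ y ∂μ, ∫⁻ x, ‖K x y‖ₑ ∂ν ≤ M) {q : ℝ}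
    (hq : 1 ≤ q) {f : Y → 𝕜} (hf : AEStronglyMeasurable f μ) :
    ∫⁻ x, ‖kernelOp μ K f x‖ₑ ^ q ∂ν ≤ M ^ q * ∫⁻ y, ‖f y‖ₑ ^ q ∂μ := by
  have hmeas : AEMeasurable (fun p : X × Y => ‖K p.1 p.2‖ₑ * ‖f p.2‖ₑ ^ q) (ν.prod μ) :=
    hK.enorm.aemeasurable.mul (hf.comp_snd.enorm.pow_const q)
  calc ∫⁻ x, ‖kernelOp μ K f x‖ₑ ^ q ∂ν
      ≤ ∫⁻ x, M ^ (q - 1) * ∫⁻ y, ‖K x y‖ₑ * ‖f y‖ₑ ^ q ∂μ ∂ν := by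
        refine lintegral_mono_ae ?_
        filter_upwards [hrow] with x hx
        have K_enorm : Measurable fun y => ‖K x y‖ₑ := (hK.comp measurable_prodMk_left).enorm
        grw [enorm_kernelOp_le, lintegral_mul_rpow_le K_enorm.aemeasurable hf.enorm hq, hx]
        exact sub_nonneg.2 hq
    _ = M ^ (q - 1) * ∫⁻ y, ∫⁻ x, ‖K x y‖ₑ * ‖f y‖ₑ ^ q ∂ν ∂μ := by
        rw [lintegral_const_mul'' _ hmeas.lintegral_prod_right', lintegral_lintegral_swap hmeas]
    _ ≤ M ^ (q - 1) * ∫⁻ y, M * ‖f y‖ₑ ^ q ∂μ := by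
        gcongr M ^ (q - 1) * ?_
        refine lintegral_mono_ae ?_
        filter_upwards [hcol] with y hy
        have K_enorm : Measurable fun x => ‖K x y‖ₑ := (hK.comp measurable_prodMk_right).enorm
        rw [lintegral_mul_const _ K_enorm]
        gcongr
    _ = M ^ q * ∫⁻ y, ‖f y‖ₑ ^ q ∂μ := by
        rw [lintegral_const_mul'' _ (hf.enorm.pow_const q), ← mul_assoc]
        congr 1
        nth_rw 2 [← ENNReal.rpow_one M]
        rw [← ENNReal.rpow_add_of_nonneg _ _ (by linarith) zero_le_one, sub_add_cancel]

theorem eLpNorm_kernelOp_le [SFinite ν] [SFinite μ] {K : X → Y → ℝ}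
    (hK : Measurable fun p : X × Y => K p.1 p.2) {M : ℝ≥0∞}
    (hrow : ∀ᵐ x ∂ν, ∫⁻ y, ‖K x y‖ₑ ∂μ ≤ M) (hcol : ∀ᵐ y ∂μ, ∫⁻ x, ‖K x y‖ₑ ∂ν ≤ M)
    {p : ℝ≥0∞} (hp : 1 ≤ p) {f : Y → 𝕜} (hf : AEStronglyMeasurable f μ) :
    eLpNorm (kernelOp μ K f) p ν ≤ M * eLpNorm f p μ := by
  rcases eq_or_ne p ∞ with rfl | p_ne_top
  · exact eLpNorm_top_kernelOp_le (fun x => hK.comp measurable_prodMk_left) hrow f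
  have p_ne_zero : p ≠ 0 := (one_pos.trans_le hp).ne'
  have one_le_toReal : 1 ≤ p.toReal := by
    rwa [← ENNReal.toReal_one, ENNReal.toReal_le_toReal ENNReal.one_ne_top p_ne_top]
  rw [eLpNorm_eq_lintegral_rpow_enorm_toReal p_ne_zero p_ne_top,
    eLpNorm_eq_lintegral_rpow_enorm_toReal p_ne_zero p_ne_top]
  grw [lintegral_enorm_kernelOp_rpow_le hK hrow hcol one_le_toReal hf]
  rw [ENNReal.mul_rpow_of_nonneg _ _ (by positivity), one_div,
    ENNReal.rpow_rpow_inv (by positivity)]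

end KernelOp

/-- A nonnegative symmetric kernel `K` dominated by `Φ ⊗ Φ` with `Φ ∈ L¹ ∩ L^∞`, so that its
integral operator is defined at every point on all of `L¹ + L^∞`. -/
structure IsDominatedKernel {X : Type*} [MeasurableSpace X] (μ : Measure X) (K : X → X → ℝ)
    (Φ : X → ℝ) : Prop where
  measurable : Measurable fun p : X × X => K p.1 p.2
  nonneg : ∀ x y, 0 ≤ K x y
  comm : ∀ x y, K x y = K y x
  le : ∀ x y, K x y ≤ Φ x * Φ y
  bound_nonneg : ∀ x, 0 ≤ Φ x
  memLp_one_bound : MemLp Φ 1 μ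
  memLp_top_bound : MemLp Φ ∞ μ

namespace IsDominatedKernel

variable {X 𝕜 : Type*} [MeasurableSpace X] [RCLike 𝕜] {μ : Measure X} {K : X → X → ℝ} {Φ : X → ℝ}

theorem const_mul (hK : IsDominatedKernel μ K Φ) {c : ℝ} (hc : 0 ≤ c) (hc_le : c ≤ 1) :
    IsDominatedKernel μ (fun x y => c * K x y) Φ where
  measurable := hK.measurable.const_mul c
  nonneg x y := mul_nonneg hc (hK.nonneg x y)
  comm x y := by rw [hK.comm]
  le x y := (mul_le_of_le_one_left (hK.nonneg x y) hc_le).trans (hK.le x y)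
  bound_nonneg := hK.bound_nonneg
  memLp_one_bound := hK.memLp_one_bound
  memLp_top_bound := hK.memLp_top_bound

theorem measurable_right (hK : IsDominatedKernel μ K Φ) (x : X) : Measurable (K x) :=
  hK.measurable.comp measurable_prodMk_left

theorem memLp_right (hK : IsDominatedKernel μ K Φ) {p : ℝ≥0∞} (hΦ : MemLp Φ p μ) (x : X) :
    MemLp (K x) p μ := by
  refine (hΦ.const_mul (Φ x)).mono (hK.measurable_right x).aestronglyMeasurable
    (ae_of_all _ fun y => ?_)
  rw [Real.norm_of_nonneg (hK.nonneg x y)]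
  exact (hK.le x y).trans (le_abs_self _)

theorem memLp_two_right (hK : IsDominatedKernel μ K Φ) (x : X) : MemLp (K x) 2 μ :=
  hK.memLp_right (memLp_two_of_memLp_one_of_memLp_top hK.memLp_one_bound hK.memLp_top_bound) x

theorem integrable_right (hK : IsDominatedKernel μ K Φ) (x : X) : Integrable (K x) μ :=
  memLp_one_iff_integrable.1 (hK.memLp_right hK.memLp_one_bound x)

theorem integrable_bound_smul (hK : IsDominatedKernel μ K Φ) {f : X → 𝕜}
    (hf : f ∈ LOneAddLInfty 𝕜 μ) : Integrable (fun y => Φ y • f y) μ := by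
  obtain ⟨g, h, hg, hh, rfl⟩ := hf
  simp only [Pi.add_apply, smul_add]
  exact (memLp_one_iff_integrable.1 (hg.smul (p := ∞) (r := 1) hK.memLp_top_bound)).add
    (memLp_one_iff_integrable.1 (hh.smul (p := 1) (r := 1) hK.memLp_one_bound))

theorem norm_smul_le (hK : IsDominatedKernel μ K Φ) (f : X → 𝕜) (x y : X) :
    ‖K x y • f y‖ ≤ Φ x * ‖Φ y • f y‖ := by
  rw [norm_smul, norm_smul, Real.norm_of_nonneg (hK.nonneg x y),
    Real.norm_of_nonneg (hK.bound_nonneg y), ← mul_assoc]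
  gcongr
  exact hK.le x y

theorem integrable_smul (hK : IsDominatedKernel μ K Φ) {f : X → 𝕜} (hf : f ∈ LOneAddLInfty 𝕜 μ)
    (x : X) : Integrable (fun y => K x y • f y) μ :=
  ((hK.integrable_bound_smul hf).norm.const_mul (Φ x)).mono'
    ((hK.measurable_right x).aestronglyMeasurable.smul
      (aestronglyMeasurable_of_mem_LOneAddLInfty hf))
    (ae_of_all _ fun y => hK.norm_smul_le f x y)

theorem kernelOp_add (hK : IsDominatedKernel μ K Φ) {f g : X → 𝕜} (hf : f ∈ LOneAddLInfty 𝕜 μ)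
    (hg : g ∈ LOneAddLInfty 𝕜 μ) : kernelOp μ K (f + g) = kernelOp μ K f + kernelOp μ K g := by
  funext x
  simp only [kernelOp, Pi.add_apply, smul_add]
  exact integral_add (hK.integrable_smul hf x) (hK.integrable_smul hg x)

theorem eLpNorm_kernelOp_le [SFinite μ] (hK : IsDominatedKernel μ K Φ) {M : ℝ}
    (hM : ∀ᵐ x ∂μ, ∫ y, K x y ∂μ ≤ M) {p : ℝ≥0∞} (hp : 1 ≤ p) {f : X → 𝕜}
    (hf : AEStronglyMeasurable f μ) :
    eLpNorm (kernelOp μ K f) p μ ≤ ENNReal.ofReal M * eLpNorm f p μ := by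
  have row_le : ∀ᵐ x ∂μ, ∫⁻ y, ‖K x y‖ₑ ∂μ ≤ ENNReal.ofReal M := by
    filter_upwards [hM] with x hx
    simp only [Real.enorm_of_nonneg (hK.nonneg _ _)]
    rw [← ofReal_integral_eq_lintegral_ofReal (hK.integrable_right x) (ae_of_all _ (hK.nonneg x))]
    exact ENNReal.ofReal_le_ofReal hx
  exact _root_.eLpNorm_kernelOp_le hK.measurable row_le (by simpa only [hK.comm] using row_le) hp hf

theorem integrable_mul_smul [SFinite μ] (hK : IsDominatedKernel μ K Φ) {K' : X → X → ℝ}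
    {Φ' : X → ℝ} (hK' : IsDominatedKernel μ K' Φ') {f : X → 𝕜} (hf : f ∈ LOneAddLInfty 𝕜 μ)
    (x : X) : Integrable (fun p : X × X => (K x p.1 * K' p.1 p.2) • f p.2) (μ.prod μ) := by
  have integrable_bound : Integrable (fun z => Φ x * (Φ z * Φ' z)) μ :=
    (memLp_one_iff_integrable.1
      (hK'.memLp_one_bound.mul' (p := ∞) (r := 1) hK.memLp_top_bound)).const_mul _
  refine (integrable_bound.mul_prod (hK'.integrable_bound_smul hf).norm).mono'
    ((((hK.measurable_right x).comp measurable_fst).mul hK'.measurable).aestronglyMeasurable.smul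
      (aestronglyMeasurable_of_mem_LOneAddLInfty hf).comp_snd) (ae_of_all _ fun p => ?_)
  calc ‖(K x p.1 * K' p.1 p.2) • f p.2‖ = K x p.1 * ‖K' p.1 p.2 • f p.2‖ := by
        rw [mul_smul, norm_smul, Real.norm_of_nonneg (hK.nonneg _ _)]
    _ ≤ (Φ x * Φ p.1) * (Φ' p.1 * ‖Φ' p.2 • f p.2‖) :=
        mul_le_mul (hK.le x p.1) (hK'.norm_smul_le f p.1 p.2) (norm_nonneg _)
          (mul_nonneg (hK.bound_nonneg _) (hK.bound_nonneg _))
    _ = Φ x * (Φ p.1 * Φ' p.1) * ‖Φ' p.2 • f p.2‖ := by ring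

theorem kernelOp_kernelOp [SFinite μ] (hK : IsDominatedKernel μ K Φ) {K' : X → X → ℝ} {Φ' : X → ℝ}
    (hK' : IsDominatedKernel μ K' Φ') {f : X → 𝕜} (hf : f ∈ LOneAddLInfty 𝕜 μ) (x : X) :
    kernelOp μ K (kernelOp μ K' f) x = kernelOp μ (fun x y => ∫ z, K x z * K' z y ∂μ) f x :=
  calc kernelOp μ K (kernelOp μ K' f) x = ∫ z, ∫ y, (K x z * K' z y) • f y ∂μ ∂μ := by
        simp only [kernelOp, ← integral_smul, mul_smul]
    _ = ∫ y, ∫ z, (K x z * K' z y) • f y ∂μ ∂μ :=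
        integral_integral_swap (hK.integrable_mul_smul hK' hf x)
    _ = kernelOp μ (fun x y => ∫ z, K x z * K' z y ∂μ) f x := by
        simp only [kernelOp, integral_smul_const]

theorem integrable_smul_mul [SFinite μ] (hK : IsDominatedKernel μ K Φ) {f g : X → 𝕜}
    (hf : f ∈ LOneAddLInfty 𝕜 μ) (hg : g ∈ LOneAddLInfty 𝕜 μ) :
    Integrable (fun p : X × X => K p.1 p.2 • (f p.2 * g p.1)) (μ.prod μ) := by
  refine ((hK.integrable_bound_smul hg).norm.mul_prod (hK.integrable_bound_smul hf).norm).mono'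
    (hK.measurable.aestronglyMeasurable.smul
      ((aestronglyMeasurable_of_mem_LOneAddLInfty hf).comp_snd.mul
        (aestronglyMeasurable_of_mem_LOneAddLInfty hg).comp_fst)) (ae_of_all _ fun p => ?_)
  rw [norm_smul, norm_smul, norm_smul, norm_mul, Real.norm_of_nonneg (hK.nonneg _ _),
    Real.norm_of_nonneg (hK.bound_nonneg _), Real.norm_of_nonneg (hK.bound_nonneg _)]
  calc K p.1 p.2 * (‖f p.2‖ * ‖g p.1‖) ≤ (Φ p.1 * Φ p.2) * (‖f p.2‖ * ‖g p.1‖) := by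
        gcongr
        exact hK.le _ _
    _ = Φ p.1 * ‖g p.1‖ * (Φ p.2 * ‖f p.2‖) := by ring

theorem integral_kernelOp_mul [SFinite μ] (hK : IsDominatedKernel μ K Φ) {f g : X → 𝕜}
    (hf : f ∈ LOneAddLInfty 𝕜 μ) (hg : g ∈ LOneAddLInfty 𝕜 μ) :
    ∫ x, kernelOp μ K f x * g x ∂μ = ∫ x, f x * kernelOp μ K g x ∂μ :=
  calc ∫ x, kernelOp μ K f x * g x ∂μ = ∫ x, ∫ y, K x y • (f y * g x) ∂μ ∂μ := by
        simp only [kernelOp, ← integral_mul_const, smul_mul_assoc]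
    _ = ∫ y, ∫ x, K x y • (f y * g x) ∂μ ∂μ := integral_integral_swap (hK.integrable_smul_mul hf hg)
    _ = ∫ x, f x * kernelOp μ K g x ∂μ := by
        simp only [kernelOp, ← integral_const_mul, mul_smul_comm, fun x y => hK.comm x y]

theorem integral_inner_kernelOp [SFinite μ] (hK : IsDominatedKernel μ K Φ) {f g : X → 𝕜}
    (hf : f ∈ LOneAddLInfty 𝕜 μ) (hg : g ∈ LOneAddLInfty 𝕜 μ) :
    ∫ x, inner 𝕜 (kernelOp μ K f x) (g x) ∂μ = ∫ x, inner 𝕜 (f x) (kernelOp μ K g x) ∂μ := by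
  have conj_mem : (fun x => starRingEnd 𝕜 (f x)) ∈ LOneAddLInfty 𝕜 μ := by
    obtain ⟨u, v, hu, hv, rfl⟩ := hf
    exact ⟨_, _, hu.star, hv.star, by funext x; simp⟩
  simp only [RCLike.inner_apply, ← kernelOp_conj]
  exact (hK.integral_kernelOp_mul hg conj_mem).symm

end IsDominatedKernel

/-! ### Completeness of the multi-dimensional Laguerre functions -/

section Orthant

variable {d : ℕ}

theorem posOrthant_eq_pi (d : ℕ) : posOrthant d = Set.univ.pi fun _ => Set.Ioi 0 := by
  ext x
  simp [posOrthant]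

theorem measurableSet_posOrthant (d : ℕ) : MeasurableSet (posOrthant d) := by
  rw [posOrthant_eq_pi]
  exact MeasurableSet.univ_pi fun _ => measurableSet_Ioi

theorem orthantVolume_eq_pi (d : ℕ) :
    orthantVolume d = Measure.pi fun _ => volume.restrict (Set.Ioi 0) := by
  rw [orthantVolume, posOrthant_eq_pi, volume_pi, Measure.restrict_pi_pi]

instance (d : ℕ) : SFinite (orthantVolume d) := by
  rw [orthantVolume]
  infer_instance

theorem ae_mem_posOrthant (d : ℕ) : ∀ᵐ x ∂(orthantVolume d), x ∈ posOrthant d :=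
  ae_restrict_mem (measurableSet_posOrthant d)

theorem integral_orthantVolume_prod (f : Fin d → ℝ → ℝ) :
    ∫ x, ∏ i, f i (x i) ∂(orthantVolume d) = ∏ i, ∫ y in Set.Ioi 0, f i y := by
  rw [orthantVolume_eq_pi]
  exact integral_fintype_prod_eq_prod f

theorem integrable_orthantVolume_prod {f : Fin d → ℝ → ℝ}
    (hf : ∀ i, IntegrableOn (f i) (Set.Ioi 0)) :
    Integrable (fun x => ∏ i, f i (x i)) (orthantVolume d) := by
  rw [orthantVolume_eq_pi]
  exact Integrable.fintype_prod hf

theorem measurable_prod_apply {f : Fin d → ℝ → ℝ} (hf : ∀ i, Measurable (f i)) :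
    Measurable fun x : Fin d → ℝ => ∏ i, f i (x i) :=
  Finset.measurable_prod _ fun i _ => (hf i).comp (measurable_pi_apply i)

theorem memLp_two_orthantVolume_prod {f : Fin d → ℝ → ℝ} (hm : ∀ i, Measurable (f i))
    (hf : ∀ i, IntegrableOn (fun x => f i x * f i x) (Set.Ioi 0)) :
    MemLp (fun x => ∏ i, f i (x i)) 2 (orthantVolume d) := by
  rw [memLp_two_iff_integrable_sq (measurable_prod_apply hm).aestronglyMeasurable]
  simp only [sq, ← Finset.prod_mul_distrib]
  exact integrable_orthantVolume_prod hf

end Orthant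

section LaguerreBasis

variable {d : ℕ} {β : Fin d → ℝ}

theorem measurable_laguerreFunPi (β : Fin d → ℝ) (k : Fin d → ℕ) :
    Measurable (laguerreFunPi β k) :=
  measurable_prod_apply fun i => measurable_laguerreFun (β i) (k i)

theorem memLp_laguerreFunPi (hβ : ∀ i, -1 < β i) (k : Fin d → ℕ) :
    MemLp (laguerreFunPi β k) 2 (orthantVolume d) :=
  memLp_two_orthantVolume_prod (fun i => measurable_laguerreFun (β i) (k i))
    fun i => integrableOn_laguerreFun_mul (hβ i) (k i) (k i)

theorem integral_laguerreFunPi_mul (hβ : ∀ i, -1 < β i) (k l : Fin d → ℕ) :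
    ∫ x, laguerreFunPi β k x * laguerreFunPi β l x ∂(orthantVolume d) =
      if k = l then 1 else 0 := by
  simp only [laguerreFunPi, ← Finset.prod_mul_distrib]
  rw [integral_orthantVolume_prod
    fun i y => laguerreFun (β i) (k i) y * laguerreFun (β i) (l i) y]
  simp only [integral_laguerreFun_mul (hβ _), Fintype.prod_ite_zero, Finset.prod_const_one,
    funext_iff]

theorem exists_prod_laguerreMonomial_eq_sum (hβ : ∀ i, -1 < β i) (n : Fin d → ℕ) :
    ∃ (s : Finset (Fin d → ℕ)) (c : (Fin d → ℕ) → ℝ), ∀ x : Fin d → ℝ,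
      ∏ i, laguerreMonomial (β i) (n i) (x i) = ∑ k ∈ s, c k * laguerreFunPi β k x := by
  choose c hc using fun i => Finsupp.mem_span_range_iff_exists_finsupp.1
    (laguerreMonomial_mem_span_range_laguerreFun (hβ i) (n i))
  refine ⟨Fintype.piFinset fun i => (c i).support, fun k => ∏ i, c i (k i), fun x => ?_⟩
  simp only [laguerreFunPi, ← Finset.prod_mul_distrib]
  rw [← Finset.prod_univ_sum (t := fun i => (c i).support)
    (f := fun i k => c i k * laguerreFun (β i) k (x i))]
  refine Finset.prod_congr rfl fun i _ => ?_
  rw [← hc i, Finsupp.sum, Finset.sum_apply]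
  simp only [Pi.smul_apply, smul_eq_mul]

theorem integral_prod_laguerreMonomial_mul_eq_zero (hβ : ∀ i, -1 < β i) {g : (Fin d → ℝ) → ℝ}
    (hg : MemLp g 2 (orthantVolume d))
    (h : ∀ k, ∫ x, laguerreFunPi β k x * g x ∂(orthantVolume d) = 0) (n : Fin d → ℕ) :
    ∫ x, (∏ i, laguerreMonomial (β i) (n i) (x i)) * g x ∂(orthantVolume d) = 0 := by
  obtain ⟨s, c, monomial_eq⟩ := exists_prod_laguerreMonomial_eq_sum hβ n
  have integrable_term (k : Fin d → ℕ) :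
      Integrable (fun x => laguerreFunPi β k x * g x) (orthantVolume d) :=
    (memLp_laguerreFunPi hβ k).integrable_mul hg
  simp only [monomial_eq, Finset.sum_mul, mul_assoc]
  rw [integral_finsetSum _ fun k _ => (integrable_term k).const_mul _]
  simp only [integral_const_mul, h, mul_zero, Finset.sum_const_zero]

theorem memLp_prod_exp_mul_laguerreMonomial_zero (hβ : ∀ i, -1 < β i) {δ : ℝ} (hδ : δ < 1 / 2) :
    MemLp (fun x => ∏ i, (Real.exp (δ * |x i|) * laguerreMonomial (β i) 0 (x i))) 2
      (orthantVolume d) := by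
  refine memLp_two_orthantVolume_prod
    (f := fun i y => Real.exp (δ * |y|) * laguerreMonomial (β i) 0 y)
    (fun i => (by fun_prop : Measurable fun y : ℝ => Real.exp (δ * |y|)).mul
      (measurable_laguerreMonomial (β i) 0)) fun i => ?_
  refine (integrableOn_rpow_mul_exp_neg_mul (hβ i) (by linarith : 0 < 1 - 2 * δ)).congr_fun
    (fun y (hy : 0 < y) => ?_) measurableSet_Ioi
  have rpow_split : y ^ β i = y ^ (β i / 2) * y ^ (β i / 2) := by
    rw [← Real.rpow_add hy, add_halves]
  have exp_split : Real.exp (-((1 - 2 * δ) * y)) =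
      Real.exp (δ * y) * Real.exp (δ * y) * (Real.exp (-y / 2) * Real.exp (-y / 2)) := by
    simp only [← Real.exp_add]
    ring_nf
  simp only [laguerreMonomial, pow_zero, one_mul, abs_of_pos hy, rpow_split, exp_split]
  ring

theorem ae_eq_zero_of_forall_integral_laguerreFunPi_mul (hβ : ∀ i, -1 < β i)
    {g : (Fin d → ℝ) → ℝ} (hg : MemLp g 2 (orthantVolume d))
    (h : ∀ k, ∫ x, laguerreFunPi β k x * g x ∂(orthantVolume d) = 0) :
    g =ᵐ[orthantVolume d] 0 := by
  let weight (x : Fin d → ℝ) : ℝ := ∏ i, laguerreMonomial (β i) 0 (x i)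
  have weight_measurable : Measurable weight :=
    measurable_prod_apply fun i => measurable_laguerreMonomial (β i) 0
  have exp_mul_integrable :
      Integrable (fun x => Real.exp (1 / 4 * ∑ i, |x i|) * (weight x * g x)) (orthantVolume d) := by
    refine ((memLp_prod_exp_mul_laguerreMonomial_zero hβ (by norm_num : (1 / 4 : ℝ) < 1 / 2)
      ).integrable_mul hg).congr (ae_of_all _ fun x => ?_)
    simp only [Pi.mul_apply, Finset.prod_mul_distrib, ← Real.exp_sum, ← Finset.mul_sum, weight,
      mul_assoc]
  have moments_eq_zero (n : Fin d → ℕ) :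
      ∫ x, (∏ i, x i ^ n i) * (weight x * g x) ∂(orthantVolume d) = 0 := by
    rw [← integral_prod_laguerreMonomial_mul_eq_zero hβ hg h n]
    simp only [weight, laguerreMonomial, pow_zero, one_mul, ← mul_assoc,
      ← Finset.prod_mul_distrib]
  filter_upwards [ae_eq_zero_of_forall_integral_prod_pow_mul_eq_zero (by norm_num)
    (weight_measurable.aestronglyMeasurable.mul hg.1) exp_mul_integrable moments_eq_zero,
    ae_mem_posOrthant d] with x hx x_mem
  refine (mul_eq_zero.1 hx).resolve_left (Finset.prod_pos fun i _ => ?_).ne'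
  have := x_mem i
  rw [laguerreMonomial]
  positivity

variable {𝕜 : Type*} [RCLike 𝕜]

/-- The Laguerre function of multi-index `k`, as an element of `L²` with scalars `𝕜`. -/
noncomputable def laguerreLp (𝕜 : Type*) [RCLike 𝕜] (hβ : ∀ i, -1 < β i) (k : Fin d → ℕ) :
    Lp 𝕜 2 (orthantVolume d) :=
  ((memLp_laguerreFunPi hβ k).ofReal (K := 𝕜)).toLp

theorem coeFn_laguerreLp (hβ : ∀ i, -1 < β i) (k : Fin d → ℕ) :
    laguerreLp 𝕜 hβ k =ᵐ[orthantVolume d] fun x => (laguerreFunPi β k x : 𝕜) :=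
  MemLp.coeFn_toLp _

theorem inner_laguerreLp (hβ : ∀ i, -1 < β i) (k : Fin d → ℕ) (f : Lp 𝕜 2 (orthantVolume d)) :
    inner 𝕜 (laguerreLp 𝕜 hβ k) f = ∫ x, laguerreFunPi β k x • f x ∂(orthantVolume d) := by
  rw [L2.inner_def]
  refine integral_congr_ae ?_
  filter_upwards [coeFn_laguerreLp (𝕜 := 𝕜) hβ k] with x hx
  rw [hx, RCLike.inner_apply, RCLike.conj_ofReal, RCLike.real_smul_eq_coe_mul, mul_comm]

theorem inner_laguerreLp_toLp (hβ : ∀ i, -1 < β i) (k : Fin d → ℕ) {f : (Fin d → ℝ) → 𝕜}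
    (hf : MemLp f 2 (orthantVolume d)) :
    inner 𝕜 (laguerreLp 𝕜 hβ k) (hf.toLp f) =
      ∫ x, laguerreFunPi β k x • f x ∂(orthantVolume d) := by
  rw [inner_laguerreLp]
  refine integral_congr_ae ?_
  filter_upwards [hf.coeFn_toLp] with x hx
  rw [hx]

theorem orthonormal_laguerreLp (hβ : ∀ i, -1 < β i) : Orthonormal 𝕜 (laguerreLp 𝕜 hβ) := by
  rw [orthonormal_iff_ite]
  intro k l
  rw [laguerreLp.eq_1 𝕜 hβ l, inner_laguerreLp_toLp]
  simp only [RCLike.real_smul_eq_coe_mul, ← RCLike.ofReal_mul]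
  rw [integral_ofReal, integral_laguerreFunPi_mul hβ]
  split_ifs <;> simp

theorem span_range_laguerreLp_orthogonal (hβ : ∀ i, -1 < β i) :
    (Submodule.span 𝕜 (Set.range (laguerreLp 𝕜 hβ)))ᗮ = ⊥ := by
  refine (Submodule.eq_bot_iff _).2 fun f hf => (Lp.eq_zero_iff_ae_eq_zero).2 ?_
  have memLp_f := Lp.memLp f
  have coeff_eq_zero (k : Fin d → ℕ) :
      ∫ x, laguerreFunPi β k x • f x ∂(orthantVolume d) = 0 := by
    rw [← inner_laguerreLp hβ]
    exact (Submodule.mem_orthogonal _ _).1 hf _ (Submodule.subset_span ⟨k, rfl⟩)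
  have coeff_integrable (k : Fin d → ℕ) :
      Integrable (fun x => laguerreFunPi β k x • f x) (orthantVolume d) :=
    memLp_one_iff_integrable.1 (memLp_f.smul (p := 2) (r := 1) (memLp_laguerreFunPi hβ k))
  have re_eq_zero := ae_eq_zero_of_forall_integral_laguerreFunPi_mul hβ memLp_f.re fun k => by
    simpa [coeff_eq_zero k, RCLike.smul_re] using integral_re (coeff_integrable k)
  have im_eq_zero := ae_eq_zero_of_forall_integral_laguerreFunPi_mul hβ memLp_f.im fun k => by
    simpa [coeff_eq_zero k, RCLike.smul_im] using integral_im (coeff_integrable k)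
  filter_upwards [re_eq_zero, im_eq_zero] with x hre him
  exact RCLike.ext (by simpa using hre) (by simpa using him)

/-- The Hilbert basis of `L²` of the orthant that consists of the Laguerre functions. -/
noncomputable def laguerreBasis (𝕜 : Type*) [RCLike 𝕜] (hβ : ∀ i, -1 < β i) :
    HilbertBasis (Fin d → ℕ) 𝕜 (Lp 𝕜 2 (orthantVolume d)) :=
  HilbertBasis.mkOfOrthogonalEqBot (orthonormal_laguerreLp hβ)
    (span_range_laguerreLp_orthogonal hβ)

theorem laguerreBasis_apply (hβ : ∀ i, -1 < β i) (k : Fin d → ℕ) :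
    laguerreBasis 𝕜 hβ k = laguerreLp 𝕜 hβ k := by
  rw [laguerreBasis, HilbertBasis.coe_mkOfOrthogonalEqBot]

theorem laguerreBasis_repr_toLp (hβ : ∀ i, -1 < β i) (k : Fin d → ℕ) {f : (Fin d → ℝ) → 𝕜}
    (hf : MemLp f 2 (orthantVolume d)) :
    (laguerreBasis 𝕜 hβ).repr (hf.toLp f) k =
      ∫ x, laguerreFunPi β k x • f x ∂(orthantVolume d) := by
  rw [HilbertBasis.repr_apply_apply, laguerreBasis_apply, inner_laguerreLp_toLp]

/-- The multi-indices of length less than `N`, over which the partial sums of Laguerre expansions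
are taken. -/
def multiIndexLT (d N : ℕ) : Finset (Fin d → ℕ) :=
  (Finset.range N).biUnion fun n => Finset.piAntidiag Finset.univ n

theorem sum_multiIndexLT {M : Type*} [AddCommMonoid M] (N : ℕ) (F : (Fin d → ℕ) → M) :
    ∑ k ∈ multiIndexLT d N, F k =
      ∑ n ∈ Finset.range N, ∑ k ∈ Finset.piAntidiag Finset.univ n, F k := by
  refine Finset.sum_biUnion fun m _ n _ hmn => Finset.disjoint_left.2 fun k hm hn => hmn ?_
  rw [Finset.mem_piAntidiag] at hm hn
  exact hm.1.symm.trans hn.1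

theorem tendsto_multiIndexLT_atTop (d : ℕ) : Tendsto (multiIndexLT d) atTop atTop := by
  refine tendsto_atTop_finset_of_monotone (fun M N h => ?_) fun k => ⟨∑ i, k i + 1, ?_⟩
  · exact Finset.biUnion_subset_biUnion_of_subset_left _ (Finset.range_subset_range.2 h)
  · simp only [multiIndexLT, Finset.mem_biUnion, Finset.mem_range, Finset.mem_piAntidiag]
    exact ⟨∑ i, k i, Nat.lt_succ_self _, rfl, fun i _ => Finset.mem_univ i⟩

theorem coeFn_sum_smul_laguerreLp (hβ : ∀ i, -1 < β i) (c : (Fin d → ℕ) → 𝕜)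
    (s : Finset (Fin d → ℕ)) :
    ((∑ k ∈ s, c k • laguerreLp 𝕜 hβ k : Lp 𝕜 2 (orthantVolume d)) : (Fin d → ℝ) → 𝕜)
      =ᵐ[orthantVolume d] fun x => ∑ k ∈ s, laguerreFunPi β k x • c k := by
  have coeFn_all : ∀ᵐ x ∂(orthantVolume d), ∀ k, (c k • laguerreLp 𝕜 hβ k) x =
      laguerreFunPi β k x • c k := by
    rw [ae_all_iff]
    intro k
    filter_upwards [Lp.coeFn_smul (c k) (laguerreLp 𝕜 hβ k),
      coeFn_laguerreLp (𝕜 := 𝕜) hβ k] with x hsmul hcoe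
    rw [hsmul, Pi.smul_apply, hcoe, smul_eq_mul, RCLike.real_smul_eq_coe_mul, mul_comm]
  filter_upwards [coeFn_all, Lp.coeFn_finsetSum s fun k => c k • laguerreLp 𝕜 hβ k]
    with x hall hsum
  simp only [hsum, hall, Finset.sum_apply]

theorem tendsto_eLpNorm_sub_sum_laguerreFunPi (hβ : ∀ i, -1 < β i) {f : (Fin d → ℝ) → 𝕜}
    (hf : MemLp f 2 (orthantVolume d)) :
    Tendsto (fun N => eLpNorm (f - fun x => ∑ k ∈ multiIndexLT d N, laguerreFunPi β k x •
        ∫ y, laguerreFunPi β k y • f y ∂(orthantVolume d)) 2 (orthantVolume d)) atTop (𝓝 0) := by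
  have tendsto_sum := ((laguerreBasis 𝕜 hβ).hasSum_repr (hf.toLp f)).comp
    (tendsto_multiIndexLT_atTop d)
  have tendsto_enorm := ((tendsto_const_nhds (x := hf.toLp f)).sub tendsto_sum).enorm
  rw [sub_self, enorm_zero] at tendsto_enorm
  refine tendsto_enorm.congr fun N => ?_
  rw [Lp.enorm_def]
  refine eLpNorm_congr_ae ?_
  simp only [Function.comp_apply, laguerreBasis_repr_toLp, laguerreBasis_apply]
  filter_upwards [Lp.coeFn_sub (hf.toLp f) (∑ k ∈ multiIndexLT d N,
    (∫ y, laguerreFunPi β k y • f y ∂(orthantVolume d)) • laguerreLp 𝕜 hβ k), hf.coeFn_toLp,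
    coeFn_sum_smul_laguerreLp hβ (fun k => ∫ y, laguerreFunPi β k y • f y ∂(orthantVolume d))
      (multiIndexLT d N)] with x hsub hf hsum
  rw [hsub, Pi.sub_apply, hf, hsum, Pi.sub_apply]

end LaguerreBasis

/-! ### The multi-dimensional heat kernel -/

section HeatKernel

variable {d : ℕ} {β : Fin d → ℝ} {t : ℝ}

/-- The unnormalised product gamma density `∏ x_i ^ s_i * exp (-δ_i x_i)`, which dominates the
heat kernel in each variable. -/
noncomputable def gammaWeight (s δ x : Fin d → ℝ) : ℝ :=
  ∏ i, x i ^ s i * Real.exp (-(δ i * x i))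

theorem gammaWeight_nonneg (s δ : Fin d → ℝ) {x : Fin d → ℝ} (hx : x ∈ posOrthant d) :
    0 ≤ gammaWeight s δ x :=
  Finset.prod_nonneg fun i _ => mul_nonneg (Real.rpow_nonneg (hx i).le _) (Real.exp_nonneg _)

theorem memLp_one_gammaWeight {s δ : Fin d → ℝ} (hs : ∀ i, -1 < s i) (hδ : ∀ i, 0 < δ i) :
    MemLp (gammaWeight s δ) 1 (orthantVolume d) :=
  memLp_one_iff_integrable.2 <|
    integrable_orthantVolume_prod fun i => integrableOn_rpow_mul_exp_neg_mul (hs i) (hδ i)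

theorem memLp_top_gammaWeight {s δ : Fin d → ℝ} (hs : ∀ i, 0 ≤ s i) (hδ : ∀ i, 0 < δ i) :
    MemLp (gammaWeight s δ) ∞ (orthantVolume d) := by
  have gammaWeight_measurable : Measurable (gammaWeight s δ) := by
    unfold gammaWeight
    fun_prop
  refine memLp_top_of_bound gammaWeight_measurable.aestronglyMeasurable
    (∏ i, ((s i + 1) / δ i) ^ s i) ?_
  filter_upwards [ae_mem_posOrthant d] with x hx
  rw [Real.norm_of_nonneg (gammaWeight_nonneg s δ hx)]
  exact Finset.prod_le_prod
    (fun i _ => mul_nonneg (Real.rpow_nonneg (hx i).le _) (Real.exp_nonneg _))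
    fun i _ => rpow_mul_exp_neg_mul_le (hs i) (hδ i) (hx i).le

/-- The heat kernel of the Laguerre semigroup in closed form: the tensor product of one-dimensional
Hille–Hardy kernels with `r = exp (-t)`, extended by zero off the orthant. -/
noncomputable def laguerreHeatKernel (β : Fin d → ℝ) (t : ℝ) (x y : Fin d → ℝ) : ℝ :=
  (posOrthant d ×ˢ posOrthant d).indicator
    (fun p => ∏ i, hilleHardyKernel (β i) (Real.exp (-t)) (p.1 i) (p.2 i)) (x, y)

theorem laguerreHeatKernel_of_mem (β : Fin d → ℝ) (t : ℝ) {x y : Fin d → ℝ}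
    (hx : x ∈ posOrthant d) (hy : y ∈ posOrthant d) :
    laguerreHeatKernel β t x y = ∏ i, hilleHardyKernel (β i) (Real.exp (-t)) (x i) (y i) :=
  Set.indicator_of_mem (s := posOrthant d ×ˢ posOrthant d) ⟨hx, hy⟩ _

theorem laguerreHeatKernel_of_notMem (β : Fin d → ℝ) (t : ℝ) {x y : Fin d → ℝ}
    (h : ¬(x ∈ posOrthant d ∧ y ∈ posOrthant d)) : laguerreHeatKernel β t x y = 0 :=
  Set.indicator_of_notMem (s := posOrthant d ×ˢ posOrthant d) h _

theorem laguerreHeatKernel_comm (β : Fin d → ℝ) (t : ℝ) (x y : Fin d → ℝ) :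
    laguerreHeatKernel β t x y = laguerreHeatKernel β t y x := by
  by_cases h : x ∈ posOrthant d ∧ y ∈ posOrthant d
  · rw [laguerreHeatKernel_of_mem β t h.1 h.2, laguerreHeatKernel_of_mem β t h.2 h.1]
    simp only [hilleHardyKernel_comm]
  · rw [laguerreHeatKernel_of_notMem β t h, laguerreHeatKernel_of_notMem β t (mt And.symm h)]

theorem laguerreHeatKernel_nonneg (hβ : ∀ i, -1 < β i) (ht : 0 ≤ t) (x y : Fin d → ℝ) :
    0 ≤ laguerreHeatKernel β t x y :=
  Set.indicator_nonneg (fun _ hp => Finset.prod_nonneg fun i _ => hilleHardyKernel_nonneg (hβ i)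
    (Real.exp_nonneg _) (Real.exp_le_one_iff.2 (neg_nonpos.2 ht)) (hp.1 i).le (hp.2 i).le) _

theorem measurable_laguerreHeatKernel (hβ : ∀ i, 0 ≤ β i) (t : ℝ) :
    Measurable fun p : (Fin d → ℝ) × (Fin d → ℝ) => laguerreHeatKernel β t p.1 p.2 :=
  (Finset.measurable_prod _ fun i _ => (measurable_hilleHardyKernel (hβ i) _).comp
    (f := fun p : (Fin d → ℝ) × (Fin d → ℝ) => (p.1 i, p.2 i)) (by fun_prop)).indicator
    ((measurableSet_posOrthant d).prod (measurableSet_posOrthant d))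

theorem exists_laguerreHeatKernel_le (hβ : ∀ i, 0 ≤ β i) (ht : 0 < t) :
    ∃ (C : ℝ) (δ : Fin d → ℝ), 0 ≤ C ∧ (∀ i, 0 < δ i) ∧ ∀ x ∈ posOrthant d, ∀ y ∈ posOrthant d,
      laguerreHeatKernel β t x y ≤
        C * (gammaWeight (fun i => β i / 2) δ x * gammaWeight (fun i => β i / 2) δ y) := by
  have exp_lt_one : Real.exp (-t) < 1 := Real.exp_lt_one_iff.2 (neg_lt_zero.2 ht)
  choose C δ hC hδ kernel_le using fun i =>
    exists_hilleHardyKernel_le (hβ i) (Real.exp_nonneg (-t)) exp_lt_one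
  refine ⟨∏ i, C i, δ, Finset.prod_nonneg fun i _ => hC i, hδ, fun x hx y hy => ?_⟩
  rw [laguerreHeatKernel_of_mem β t hx hy, gammaWeight, gammaWeight, ← Finset.prod_mul_distrib,
    ← Finset.prod_mul_distrib]
  refine Finset.prod_le_prod (fun i _ => hilleHardyKernel_nonneg (by linarith [hβ i])
    (Real.exp_nonneg _) exp_lt_one.le (hx i).le (hy i).le) fun i _ => ?_
  rw [← mul_assoc]
  exact kernel_le i _ _ (hx i).le (hy i).le

theorem exists_isDominatedKernel_laguerreHeatKernel (hβ : ∀ i, 0 ≤ β i) (ht : 0 < t) :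
    ∃ Φ, IsDominatedKernel (orthantVolume d) (laguerreHeatKernel β t) Φ := by
  obtain ⟨C, δ, hC, hδ, kernel_le⟩ := exists_laguerreHeatKernel_le hβ ht
  have half_nonneg (i : Fin d) : 0 ≤ β i / 2 := div_nonneg (hβ i) zero_le_two
  set w := gammaWeight (fun i => β i / 2) δ
  have bound_nonneg : ∀ x, 0 ≤ (posOrthant d).indicator (fun x => √C * w x) x :=
    Set.indicator_nonneg fun x hx => mul_nonneg (Real.sqrt_nonneg C) (gammaWeight_nonneg _ _ hx)
  refine ⟨(posOrthant d).indicator fun x => √C * w x, measurable_laguerreHeatKernel hβ t,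
    laguerreHeatKernel_nonneg (fun i => by linarith [hβ i]) ht.le, laguerreHeatKernel_comm β t,
    fun x y => ?_, bound_nonneg,
    ((memLp_one_gammaWeight (fun i => by linarith [half_nonneg i]) hδ).const_mul _).indicator
      (measurableSet_posOrthant d),
    ((memLp_top_gammaWeight half_nonneg hδ).const_mul _).indicator (measurableSet_posOrthant d)⟩
  by_cases h : x ∈ posOrthant d ∧ y ∈ posOrthant d
  · rw [Set.indicator_of_mem h.1, Set.indicator_of_mem h.2, mul_mul_mul_comm,
      Real.mul_self_sqrt hC]
    exact kernel_le x h.1 y h.2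
  · rw [laguerreHeatKernel_of_notMem β t h]
    exact mul_nonneg (bound_nonneg x) (bound_nonneg y)

theorem two_mul_sqrt_exp_neg_div_eq_inv_cosh (t : ℝ) :
    2 * √(Real.exp (-t)) / (1 + Real.exp (-t)) = (Real.cosh (t / 2))⁻¹ := by
  have exp_neg : Real.exp (-t) = Real.exp (-(t / 2)) * Real.exp (-(t / 2)) := by
    rw [← Real.exp_add]
    ring_nf
  have exp_mul_exp_neg : Real.exp (t / 2) * Real.exp (-(t / 2)) = 1 := by
    rw [← Real.exp_add, add_neg_cancel, Real.exp_zero]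
  rw [exp_neg, Real.sqrt_mul_self (Real.exp_nonneg _), Real.cosh_eq, inv_div,
    div_eq_div_iff (by positivity) (by positivity)]
  linear_combination 2 * exp_mul_exp_neg

theorem integral_laguerreHeatKernel_le (hβ : ∀ i, 0 ≤ β i) (ht : 0 < t) {x : Fin d → ℝ}
    (hx : x ∈ posOrthant d) :
    ∫ y, laguerreHeatKernel β t x y ∂(orthantVolume d) ≤ (Real.cosh (t / 2) ^ d)⁻¹ := by
  have exp_lt_one : Real.exp (-t) < 1 := Real.exp_lt_one_iff.2 (neg_lt_zero.2 ht)
  calc ∫ y, laguerreHeatKernel β t x y ∂(orthantVolume d)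
      = ∫ y, ∏ i, hilleHardyKernel (β i) (Real.exp (-t)) (x i) (y i) ∂(orthantVolume d) := by
        refine integral_congr_ae ?_
        filter_upwards [ae_mem_posOrthant d] with y hy using laguerreHeatKernel_of_mem β t hx hy
    _ = ∏ i, ∫ y in Set.Ioi 0, hilleHardyKernel (β i) (Real.exp (-t)) (x i) y :=
        integral_orthantVolume_prod fun i => hilleHardyKernel (β i) (Real.exp (-t)) (x i)
    _ ≤ ∏ _i : Fin d, (Real.cosh (t / 2))⁻¹ := by
        refine Finset.prod_le_prod (fun i _ => setIntegral_nonneg measurableSet_Ioi fun y hy =>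
          hilleHardyKernel_nonneg (by linarith [hβ i]) (Real.exp_nonneg _) exp_lt_one.le
            (hx i).le (le_of_lt hy)) fun i _ => ?_
        rw [← two_mul_sqrt_exp_neg_div_eq_inv_cosh]
        exact integral_hilleHardyKernel_le (hβ i) (Real.exp_pos _) exp_lt_one (hx i)
    _ = (Real.cosh (t / 2) ^ d)⁻¹ := by
        rw [Finset.prod_const, Finset.card_univ, Fintype.card_fin, inv_pow]

theorem prod_exp_neg_rpow_mul_pow (β : Fin d → ℝ) (t : ℝ) (k : Fin d → ℕ) :
    ∏ i, (Real.exp (-t) ^ ((β i + 1) / 2) * Real.exp (-t) ^ k i) =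
      Real.exp (-t * laguerreEigenvalue β (∑ i, k i)) := by
  have factor_eq (i : Fin d) : Real.exp (-t) ^ ((β i + 1) / 2) * Real.exp (-t) ^ k i =
      Real.exp (-t * (k i + (β i + 1) / 2)) := by
    rw [← Real.exp_mul, ← Real.exp_nat_mul, ← Real.exp_add]
    ring_nf
  simp only [factor_eq, ← Real.exp_sum, ← Finset.mul_sum, Finset.sum_add_distrib,
    ← Finset.sum_div, laguerreEigenvalue, Finset.sum_const, Finset.card_univ, Fintype.card_fin,
    nsmul_eq_mul, mul_one, Nat.cast_sum]

theorem integral_laguerreHeatKernel_mul_laguerreFunPi (hβ : ∀ i, 0 ≤ β i) (ht : 0 < t)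
    {x : Fin d → ℝ} (hx : x ∈ posOrthant d) (k : Fin d → ℕ) :
    ∫ y, laguerreHeatKernel β t x y * laguerreFunPi β k y ∂(orthantVolume d) =
      Real.exp (-t * laguerreEigenvalue β (∑ i, k i)) * laguerreFunPi β k x := by
  have exp_lt_one : Real.exp (-t) < 1 := Real.exp_lt_one_iff.2 (neg_lt_zero.2 ht)
  calc ∫ y, laguerreHeatKernel β t x y * laguerreFunPi β k y ∂(orthantVolume d)
      = ∫ y, ∏ i, (hilleHardyKernel (β i) (Real.exp (-t)) (x i) (y i) *
          laguerreFun (β i) (k i) (y i)) ∂(orthantVolume d) := by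
        refine integral_congr_ae ?_
        filter_upwards [ae_mem_posOrthant d] with y hy
        rw [laguerreHeatKernel_of_mem β t hx hy, laguerreFunPi, ← Finset.prod_mul_distrib]
    _ = ∏ i, ∫ y in Set.Ioi 0, hilleHardyKernel (β i) (Real.exp (-t)) (x i) y *
          laguerreFun (β i) (k i) y :=
        integral_orthantVolume_prod fun i y =>
          hilleHardyKernel (β i) (Real.exp (-t)) (x i) y * laguerreFun (β i) (k i) y
    _ = ∏ i, (Real.exp (-t) ^ ((β i + 1) / 2) * Real.exp (-t) ^ k i *
          laguerreFun (β i) (k i) (x i)) :=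
        Finset.prod_congr rfl fun i _ => integral_hilleHardyKernel_mul_laguerreFun (hβ i)
          (Real.exp_nonneg _) exp_lt_one (hx i).le (k i)
    _ = Real.exp (-t * laguerreEigenvalue β (∑ i, k i)) * laguerreFunPi β k x := by
        rw [Finset.prod_mul_distrib, prod_exp_neg_rpow_mul_pow, laguerreFunPi]

theorem hasSum_integral_laguerreHeatKernel_mul (hβ : ∀ i, 0 ≤ β i) {s : ℝ} (hs : 0 < s)
    (ht : 0 < t) {x y : Fin d → ℝ} (hx : x ∈ posOrthant d) (hy : y ∈ posOrthant d) :
    HasSum (fun k : Fin d → ℕ => Real.exp (-(s + t) * laguerreEigenvalue β (∑ i, k i)) *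
        (laguerreFunPi β k x * laguerreFunPi β k y))
      (∫ z, laguerreHeatKernel β s x z * laguerreHeatKernel β t z y ∂(orthantVolume d)) := by
  obtain ⟨Φ, hΦ⟩ := exists_isDominatedKernel_laguerreHeatKernel hβ hs
  obtain ⟨Ψ, hΨ⟩ := exists_isDominatedKernel_laguerreHeatKernel hβ ht
  have memLp_x := hΦ.memLp_two_right x
  have memLp_y := hΨ.memLp_two_right y
  have inner_eq : inner ℝ (memLp_x.toLp _) (memLp_y.toLp _) =
      ∫ z, laguerreHeatKernel β s x z * laguerreHeatKernel β t z y ∂(orthantVolume d) := by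
    rw [L2.inner_def]
    refine integral_congr_ae ?_
    filter_upwards [memLp_x.coeFn_toLp, memLp_y.coeFn_toLp] with z hzx hzy
    rw [hzx, hzy, laguerreHeatKernel_comm β t z y, real_inner_eq_re_inner, RCLike.inner_apply']
    rfl
  have neg_one_lt (i : Fin d) : -1 < β i := by linarith [hβ i]
  have parseval := (laguerreBasis ℝ neg_one_lt).hasSum_inner_mul_inner
    (memLp_x.toLp _) (memLp_y.toLp _)
  rw [inner_eq] at parseval
  refine parseval.congr_fun fun k => ?_
  rw [real_inner_comm, laguerreBasis_apply, inner_laguerreLp_toLp, inner_laguerreLp_toLp]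
  simp only [smul_eq_mul, mul_comm (laguerreFunPi β k _) (laguerreHeatKernel _ _ _ _)]
  rw [integral_laguerreHeatKernel_mul_laguerreFunPi hβ hs hx,
    integral_laguerreHeatKernel_mul_laguerreFunPi hβ ht hy, neg_add, add_mul, Real.exp_add]
  ring

theorem laguerreKernelTerm_eq_sum (β : Fin d → ℝ) (t : ℝ) (x y : Fin d → ℝ) (n : ℕ) :
    laguerreKernelTerm β t x y n = ∑ k ∈ Finset.piAntidiag Finset.univ n,
      Real.exp (-t * laguerreEigenvalue β (∑ i, k i)) *
        (laguerreFunPi β k x * laguerreFunPi β k y) := by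
  rw [laguerreKernelTerm, Finset.mul_sum]
  refine Finset.sum_congr rfl fun k hk => ?_
  rw [(Finset.mem_piAntidiag.1 hk).1]

theorem summable_exp_neg_mul_laguerreFunPi_mul (hβ : ∀ i, 0 ≤ β i) (ht : 0 < t)
    {x y : Fin d → ℝ} (hx : x ∈ posOrthant d) (hy : y ∈ posOrthant d) :
    Summable fun k : Fin d → ℕ => Real.exp (-t * laguerreEigenvalue β (∑ i, k i)) *
        (laguerreFunPi β k x * laguerreFunPi β k y) := by
  simpa only [add_halves] using
    (hasSum_integral_laguerreHeatKernel_mul hβ (half_pos ht) (half_pos ht) hx hy).summable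

theorem summable_laguerreKernelTerm (hβ : ∀ i, 0 ≤ β i) (ht : 0 < t) {x y : Fin d → ℝ}
    (hx : x ∈ posOrthant d) (hy : y ∈ posOrthant d) :
    Summable (laguerreKernelTerm β t x y) := by
  have summable_norm := (summable_exp_neg_mul_laguerreFunPi_mul hβ ht hx hy).norm
  refine Summable.of_norm (summable_of_sum_range_le (c := ∑' k : Fin d → ℕ,
    ‖Real.exp (-t * laguerreEigenvalue β (∑ i, k i)) *
      (laguerreFunPi β k x * laguerreFunPi β k y)‖) (fun _ => norm_nonneg _) fun N => ?_)
  refine le_trans (Finset.sum_le_sum fun n _ => ?_) ((sum_multiIndexLT N _).ge.trans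
    (summable_norm.sum_le_tsum (multiIndexLT d N) fun _ _ => norm_nonneg _))
  rw [laguerreKernelTerm_eq_sum]
  exact norm_sum_le _ _

theorem laguerreKernel_eq_tsum (hβ : ∀ i, 0 ≤ β i) (ht : 0 < t) {x y : Fin d → ℝ}
    (hx : x ∈ posOrthant d) (hy : y ∈ posOrthant d) :
    laguerreKernel β t x y = ∑' k : Fin d → ℕ,
      Real.exp (-t * laguerreEigenvalue β (∑ i, k i)) *
        (laguerreFunPi β k x * laguerreFunPi β k y) := by
  have tendsto_multiIndex := (summable_exp_neg_mul_laguerreFunPi_mul hβ ht hx hy).hasSum.comp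
    (tendsto_multiIndexLT_atTop d)
  refine tendsto_nhds_unique (summable_laguerreKernelTerm hβ ht hx hy).hasSum.tendsto_sum_nat
    (tendsto_multiIndex.congr fun N => ?_)
  simp only [Function.comp_apply, sum_multiIndexLT, laguerreKernelTerm_eq_sum]

theorem laguerreKernel_add_eq_integral (hβ : ∀ i, 0 ≤ β i) {s : ℝ} (hs : 0 < s) (ht : 0 < t)
    {x y : Fin d → ℝ} (hx : x ∈ posOrthant d) (hy : y ∈ posOrthant d) :
    laguerreKernel β (s + t) x y =
      ∫ z, laguerreHeatKernel β s x z * laguerreHeatKernel β t z y ∂(orthantVolume d) := by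
  rw [laguerreKernel_eq_tsum hβ (add_pos hs ht) hx hy]
  exact (hasSum_integral_laguerreHeatKernel_mul hβ hs ht hx hy).tsum_eq

/-- The Laguerre expansion of the closed-form kernel in `L²` converges a.e. along a subsequence, so
its sum agrees a.e. with that of the pointwise convergent series. -/
theorem laguerreKernel_ae_eq_laguerreHeatKernel (hβ : ∀ i, 0 ≤ β i) (ht : 0 < t) {x : Fin d → ℝ}
    (hx : x ∈ posOrthant d) :
    laguerreKernel β t x =ᵐ[orthantVolume d] laguerreHeatKernel β t x := by
  obtain ⟨Φ, hΦ⟩ := exists_isDominatedKernel_laguerreHeatKernel hβ ht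
  have memLp_x := hΦ.memLp_two_right x
  have neg_one_lt (i : Fin d) : -1 < β i := by linarith [hβ i]
  have tendsto_L2 := tendsto_eLpNorm_sub_sum_laguerreFunPi neg_one_lt memLp_x
  simp only [smul_eq_mul, mul_comm (laguerreFunPi β _ _) (laguerreHeatKernel _ _ _ _),
    integral_laguerreHeatKernel_mul_laguerreFunPi hβ ht hx,
    eLpNorm_sub_comm (laguerreHeatKernel β t x)] at tendsto_L2
  have tendsto_measure := tendstoInMeasure_of_tendsto_eLpNorm two_ne_zero
    (fun N => (Finset.measurable_sum _ fun k _ =>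
      (measurable_laguerreFunPi β k).mul_const _).aestronglyMeasurable) memLp_x.1 tendsto_L2
  obtain ⟨N, hN, tendsto_ae⟩ := tendsto_measure.exists_seq_tendsto_ae
  filter_upwards [tendsto_ae, ae_mem_posOrthant d] with y tendsto_y hy
  have tendsto_series := (summable_exp_neg_mul_laguerreFunPi_mul hβ ht hx hy).hasSum.comp
    ((tendsto_multiIndexLT_atTop d).comp hN.tendsto_atTop)
  rw [← laguerreKernel_eq_tsum hβ ht hx hy] at tendsto_series
  refine tendsto_nhds_unique tendsto_series (tendsto_y.congr fun n => ?_)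
  exact Finset.sum_congr rfl fun k _ => by ring

theorem integral_laguerreHeatKernel_mul_ae_eq (hβ : ∀ i, 0 ≤ β i) {s : ℝ} (hs : 0 < s)
    (ht : 0 < t) {x : Fin d → ℝ} (hx : x ∈ posOrthant d) :
    (fun y => ∫ z, laguerreHeatKernel β s x z * laguerreHeatKernel β t z y ∂(orthantVolume d))
      =ᵐ[orthantVolume d] laguerreHeatKernel β (s + t) x := by
  filter_upwards [laguerreKernel_ae_eq_laguerreHeatKernel hβ (add_pos hs ht) hx,
    ae_mem_posOrthant d] with y kernel_eq hy
  rw [← kernel_eq, laguerreKernel_add_eq_integral hβ hs ht hx hy]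

end HeatKernel

/-! ### Semigroups of integral operators -/

/-- `T` is the identity at time `0` and, for `t > 0`, agrees a.e. with the integral operator of a
dominated kernel `K t`, where the kernels have mass at most one and satisfy the Chapman–Kolmogorov
equations. -/
structure IsKernelSemigroup {X 𝕜 : Type*} [MeasurableSpace X] [RCLike 𝕜] (μ : Measure X)
    (K : ℝ≥0 → X → X → ℝ) (T : ℝ≥0 → (X → 𝕜) → X → 𝕜) : Prop where
  exists_isDominatedKernel : ∀ t, 0 < t → ∃ Φ, IsDominatedKernel μ (K t) Φ
  integral_le_one : ∀ t, 0 < t → ∀ᵐ x ∂μ, ∫ y, K t x y ∂μ ≤ 1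
  integral_mul_ae_eq : ∀ s t, 0 < s → 0 < t → ∀ᵐ x ∂μ,
    (fun y => ∫ z, K s x z * K t z y ∂μ) =ᵐ[μ] K (s + t) x
  zero_apply : ∀ f, T 0 f = f
  ae_eq_kernelOp : ∀ t, 0 < t → ∀ f, T t f =ᵐ[μ] kernelOp μ (K t) f

namespace IsKernelSemigroup

variable {X 𝕜 : Type*} [MeasurableSpace X] [RCLike 𝕜] {μ : Measure X} {K : ℝ≥0 → X → X → ℝ}
  {T : ℝ≥0 → (X → 𝕜) → X → 𝕜}

theorem apply_congr (hT : IsKernelSemigroup μ K T) (t : ℝ≥0) {f g : X → 𝕜} (hfg : f =ᵐ[μ] g) :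
    T t f =ᵐ[μ] T t g := by
  rcases eq_zero_or_pos t with rfl | ht
  · simpa only [hT.zero_apply] using hfg
  filter_upwards [hT.ae_eq_kernelOp t ht f, hT.ae_eq_kernelOp t ht g] with x hf hg
  rw [hf, hg, kernelOp_congr _ hfg]

theorem apply_add (hT : IsKernelSemigroup μ K T) (t : ℝ≥0) {f g : X → 𝕜}
    (hf : f ∈ LOneAddLInfty 𝕜 μ) (hg : g ∈ LOneAddLInfty 𝕜 μ) :
    T t (f + g) =ᵐ[μ] T t f + T t g := by
  rcases eq_zero_or_pos t with rfl | ht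
  · simp only [hT.zero_apply, EventuallyEq.rfl]
  obtain ⟨Φ, hΦ⟩ := hT.exists_isDominatedKernel t ht
  filter_upwards [hT.ae_eq_kernelOp t ht f, hT.ae_eq_kernelOp t ht g,
    hT.ae_eq_kernelOp t ht (f + g)] with x hTf hTg hTfg
  rw [hTfg, hΦ.kernelOp_add hf hg, Pi.add_apply, Pi.add_apply, hTf, hTg]

theorem apply_smul (hT : IsKernelSemigroup μ K T) (t : ℝ≥0) (c : 𝕜) (f : X → 𝕜) :
    T t (c • f) =ᵐ[μ] c • T t f := by
  rcases eq_zero_or_pos t with rfl | ht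
  · simp only [hT.zero_apply, EventuallyEq.rfl]
  filter_upwards [hT.ae_eq_kernelOp t ht f, hT.ae_eq_kernelOp t ht (c • f)] with x hTf hTcf
  rw [hTcf, kernelOp_smul, Pi.smul_apply, Pi.smul_apply, hTf]

theorem aestronglyMeasurable_apply [SFinite μ] (hT : IsKernelSemigroup μ K T) (t : ℝ≥0)
    {f : X → 𝕜} (hf : AEStronglyMeasurable f μ) : AEStronglyMeasurable (T t f) μ := by
  rcases eq_zero_or_pos t with rfl | ht
  · rwa [hT.zero_apply]
  obtain ⟨Φ, hΦ⟩ := hT.exists_isDominatedKernel t ht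
  exact (aestronglyMeasurable_kernelOp hΦ.measurable hf).congr (hT.ae_eq_kernelOp t ht f).symm

theorem lpOpNorm_le [SFinite μ] (hT : IsKernelSemigroup μ K T) {t : ℝ≥0} (ht : 0 < t) {M : ℝ}
    (hM : ∀ᵐ x ∂μ, ∫ y, K t x y ∂μ ≤ M) {p : ℝ≥0∞} (hp : 1 ≤ p) :
    lpOpNorm μ p (T t) ≤ ENNReal.ofReal M := by
  obtain ⟨Φ, hΦ⟩ := hT.exists_isDominatedKernel t ht
  refine iSup_le fun ⟨f, hf, norm_le_one⟩ => ?_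
  calc eLpNorm (T t f) p μ = eLpNorm (kernelOp μ (K t) f) p μ :=
        eLpNorm_congr_ae (hT.ae_eq_kernelOp t ht f)
    _ ≤ ENNReal.ofReal M * eLpNorm f p μ := hΦ.eLpNorm_kernelOp_le hM hp hf.1
    _ ≤ ENNReal.ofReal M := mul_le_of_le_one_right zero_le norm_le_one

theorem eLpNorm_apply_le [SFinite μ] (hT : IsKernelSemigroup μ K T) (t : ℝ≥0) {p : ℝ≥0∞}
    (hp : 1 ≤ p) {f : X → 𝕜} (hf : AEStronglyMeasurable f μ) :
    eLpNorm (T t f) p μ ≤ eLpNorm f p μ := by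
  rcases eq_zero_or_pos t with rfl | ht
  · rw [hT.zero_apply]
  obtain ⟨Φ, hΦ⟩ := hT.exists_isDominatedKernel t ht
  rw [eLpNorm_congr_ae (hT.ae_eq_kernelOp t ht f)]
  simpa only [ENNReal.ofReal_one, one_mul] using
    hΦ.eLpNorm_kernelOp_le (hT.integral_le_one t ht) hp hf

theorem memLp_apply [SFinite μ] (hT : IsKernelSemigroup μ K T) (t : ℝ≥0) {p : ℝ≥0∞} (hp : 1 ≤ p)
    {f : X → 𝕜} (hf : MemLp f p μ) : MemLp (T t f) p μ :=
  ⟨hT.aestronglyMeasurable_apply t hf.1, (hT.eLpNorm_apply_le t hp hf.1).trans_lt hf.2⟩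

theorem add_apply [SFinite μ] (hT : IsKernelSemigroup μ K T) (s t : ℝ≥0) {f : X → 𝕜}
    (hf : f ∈ LOneAddLInfty 𝕜 μ) : T (s + t) f =ᵐ[μ] T s (T t f) := by
  rcases eq_zero_or_pos s with rfl | hs
  · rw [zero_add, hT.zero_apply]
  rcases eq_zero_or_pos t with rfl | ht
  · rw [add_zero, hT.zero_apply]
  obtain ⟨Φ, hΦ⟩ := hT.exists_isDominatedKernel s hs
  obtain ⟨Ψ, hΨ⟩ := hT.exists_isDominatedKernel t ht
  filter_upwards [hT.ae_eq_kernelOp (s + t) (add_pos hs ht) f, hT.ae_eq_kernelOp s hs (T t f),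
    hT.integral_mul_ae_eq s t hs ht] with x hadd hcomp kernel_ae_eq
  rw [hadd, hcomp, kernelOp_congr _ (hT.ae_eq_kernelOp t ht f), hΦ.kernelOp_kernelOp hΨ hf]
  refine integral_congr_ae ?_
  filter_upwards [kernel_ae_eq] with y hy
  rw [hy]

theorem integral_inner_apply [SFinite μ] (hT : IsKernelSemigroup μ K T) (t : ℝ≥0) {f g : X → 𝕜}
    (hf : f ∈ LOneAddLInfty 𝕜 μ) (hg : g ∈ LOneAddLInfty 𝕜 μ) :
    ∫ x, inner 𝕜 (T t f x) (g x) ∂μ = ∫ x, inner 𝕜 (f x) (T t g x) ∂μ := by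
  rcases eq_zero_or_pos t with rfl | ht
  · simp only [hT.zero_apply]
  obtain ⟨Φ, hΦ⟩ := hT.exists_isDominatedKernel t ht
  calc ∫ x, inner 𝕜 (T t f x) (g x) ∂μ = ∫ x, inner 𝕜 (kernelOp μ (K t) f x) (g x) ∂μ := by
        refine integral_congr_ae ?_
        filter_upwards [hT.ae_eq_kernelOp t ht f] with x hx
        rw [hx]
    _ = ∫ x, inner 𝕜 (f x) (kernelOp μ (K t) g x) ∂μ := hΦ.integral_inner_kernelOp hf hg
    _ = ∫ x, inner 𝕜 (f x) (T t g x) ∂μ := by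
        refine integral_congr_ae ?_
        filter_upwards [hT.ae_eq_kernelOp t ht g] with x hx
        rw [hx]

theorem isSymmetricDiffusionSemigroup [SFinite μ] (hT : IsKernelSemigroup μ K T)
    (tendsto : ∀ f : X → 𝕜, MemLp f 2 μ →
      Tendsto (fun t : ℝ≥0 => eLpNorm (T t f - f) 2 μ) (𝓝[>] 0) (𝓝 0)) :
    IsSymmetricDiffusionSemigroup μ (LOneAddLInfty 𝕜 μ) T where
  measurable_of_mem _ := aestronglyMeasurable_of_mem_LOneAddLInfty
  mem_of_memLp _ hp _ := mem_LOneAddLInfty_of_memLp hp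
  measurable_map t _ hf :=
    hT.aestronglyMeasurable_apply t (aestronglyMeasurable_of_mem_LOneAddLInfty hf)
  congr t _ _ _ _ := hT.apply_congr t
  map_add t _ hf _ hg := hT.apply_add t hf hg
  map_smul t c f _ := hT.apply_smul t c f
  zero f _ := by rw [hT.zero_apply]
  memLp _ hp t _ := hT.memLp_apply t hp
  contraction _ hp t := iSup_le fun f => (hT.eLpNorm_apply_le t hp f.2.1.1).trans f.2.2
  semigroup _ hp s t _ hf := hT.add_apply s t (mem_LOneAddLInfty_of_memLp hp hf)
  selfAdjoint t _ _ hf hg := hT.integral_inner_apply t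
    (mem_LOneAddLInfty_of_memLp one_le_two hf) (mem_LOneAddLInfty_of_memLp one_le_two hg)
  tendsto := tendsto

theorem isPositivityPreserving (hT : IsKernelSemigroup μ K T) (D : Submodule 𝕜 (X → 𝕜)) :
    IsPositivityPreserving μ D T := by
  intro t f _ f_nonneg
  rcases eq_zero_or_pos t with rfl | ht
  · rwa [hT.zero_apply]
  obtain ⟨Φ, hΦ⟩ := hT.exists_isDominatedKernel t ht
  filter_upwards [hT.ae_eq_kernelOp t ht f] with x hx
  rw [hx]
  exact kernelOp_nonneg (hΦ.nonneg x) f_nonneg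

theorem apply_one_ae_eq (hT : IsKernelSemigroup μ K T) {t : ℝ≥0} (ht : 0 < t) :
    T t (fun _ => 1) =ᵐ[μ] fun x => ((∫ y, K t x y ∂μ : ℝ) : 𝕜) := by
  filter_upwards [hT.ae_eq_kernelOp t ht fun _ => 1] with x hx
  have kernelOp_one := kernelOp_ofReal (𝕜 := 𝕜) (μ := μ) (K t) (fun _ => 1) x
  simp only [RCLike.ofReal_one] at kernelOp_one
  rw [hx, kernelOp_one]
  simp only [kernelOp, smul_eq_mul, mul_one]

theorem isSubmarkovian [SFinite μ] (hT : IsKernelSemigroup μ K T)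
    (tendsto : ∀ f : X → 𝕜, MemLp f 2 μ →
      Tendsto (fun t : ℝ≥0 => eLpNorm (T t f - f) 2 μ) (𝓝[>] 0) (𝓝 0)) :
    IsSubmarkovian μ (LOneAddLInfty 𝕜 μ) T := by
  refine ⟨hT.isSymmetricDiffusionSemigroup tendsto, hT.isPositivityPreserving _, fun t => ?_⟩
  rcases eq_zero_or_pos t with rfl | ht
  · rw [hT.zero_apply]
    exact ae_of_all _ fun _ => le_rfl
  filter_upwards [hT.apply_one_ae_eq ht, hT.integral_le_one t ht] with x hx integral_le
  rwa [hx, ← RCLike.ofReal_one, RCLike.ofReal_le_ofReal]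

theorem not_isMarkovian [NeZero μ] (hT : IsKernelSemigroup μ K T) {t : ℝ≥0} (ht : 0 < t)
    (hlt : ∀ᵐ x ∂μ, ∫ y, K t x y ∂μ < 1) (D : Submodule 𝕜 (X → 𝕜)) : ¬ IsMarkovian μ D T := by
  rintro ⟨-, -, apply_one⟩
  obtain ⟨x, hx, hx_one, integral_lt⟩ :=
    ((hT.apply_one_ae_eq ht).and ((apply_one t).and hlt)).exists
  rw [hx, ← RCLike.ofReal_one, RCLike.ofReal_inj] at hx_one
  exact integral_lt.ne hx_one

end IsKernelSemigroup

section HilbertBasis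

variable {ι 𝕜 E : Type*} [RCLike 𝕜] [NormedAddCommGroup E] [InnerProductSpace 𝕜 E]

theorem hasSum_norm_sq_repr (b : HilbertBasis ι 𝕜 E) (x : E) :
    HasSum (fun i => ‖b.repr x i‖ ^ 2) (‖x‖ ^ 2) := by
  have parseval := lp.hasSum_norm (p := 2) (by norm_num) (b.repr x)
  simpa only [ENNReal.toReal_ofNat, Real.rpow_ofNat, LinearIsometryEquiv.norm_map] using parseval

theorem tendsto_of_repr_eq_exp_smul (b : HilbertBasis ι 𝕜 E) {κ : ι → ℝ} (hκ : ∀ i, 0 ≤ κ i)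
    {F : ℝ≥0 → E} {x : E}
    (hF : ∀ t i, b.repr (F t) i = Real.exp (-(t : ℝ) * κ i) • b.repr x i) :
    Tendsto F (𝓝 0) (𝓝 x) := by
  have norm_sq_repr_sub (t : ℝ≥0) (i : ι) : ‖b.repr (F t - x) i‖ ^ 2 =
      (1 - Real.exp (-(t : ℝ) * κ i)) ^ 2 * ‖b.repr x i‖ ^ 2 := by
    rw [map_sub, lp.coeFn_sub, Pi.sub_apply, hF, ← neg_sub, norm_neg, ← one_smul ℝ (b.repr x i),
      smul_smul, mul_one, ← sub_smul, norm_smul, mul_pow, Real.norm_eq_abs, sq_abs, one_smul]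
  have factor_le_one (t : ℝ≥0) (i : ι) : (1 - Real.exp (-(t : ℝ) * κ i)) ^ 2 ≤ 1 := by
    have exp_le_one : Real.exp (-(t : ℝ) * κ i) ≤ 1 := Real.exp_le_one_iff.2 <|
      mul_nonpos_of_nonpos_of_nonneg (neg_nonpos.2 t.coe_nonneg) (hκ i)
    exact pow_le_one₀ (sub_nonneg.2 exp_le_one) (sub_le_self 1 (Real.exp_nonneg _))
  have tendsto_tsum : Tendsto (fun t : ℝ≥0 => ∑' i, ‖b.repr (F t - x) i‖ ^ 2) (𝓝 0)
      (𝓝 (∑' _ : ι, (0 : ℝ))) := by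
    refine tendsto_tsum_of_dominated_convergence (hasSum_norm_sq_repr b x).summable (fun i => ?_)
      (Eventually.of_forall fun t i => ?_)
    · have continuous_term : Continuous fun t : ℝ≥0 =>
          (1 - Real.exp (-(t : ℝ) * κ i)) ^ 2 * ‖b.repr x i‖ ^ 2 := by fun_prop
      simp only [norm_sq_repr_sub]
      simpa using continuous_term.tendsto 0
    · rw [norm_sq_repr_sub, Real.norm_of_nonneg (by positivity)]
      exact mul_le_of_le_one_left (by positivity) (factor_le_one t i)
  simp only [(hasSum_norm_sq_repr b _).tsum_eq, tsum_zero] at tendsto_tsum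
  rw [tendsto_iff_norm_sub_tendsto_zero]
  simpa only [Real.sqrt_sq (norm_nonneg _), Real.sqrt_zero] using tendsto_tsum.sqrt

end HilbertBasis

/-! ### The modified semigroup -/

section ModifiedHeatKernel

variable {d : ℕ} {β : Fin d → ℝ} {t : ℝ} {𝕜 : Type*} [RCLike 𝕜]

/-- The kernel of `exp(-t (L + 1/2))` in closed form, where `L` is the Laguerre operator of order
`β`; like `laguerreHeatKernel` it vanishes off the orthant. -/
noncomputable def modifiedHeatKernel (β : Fin d → ℝ) (t : ℝ) (x y : Fin d → ℝ) : ℝ :=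
  Real.exp (-t / 2) * laguerreHeatKernel β t x y

theorem exists_isDominatedKernel_modifiedHeatKernel (hβ : ∀ i, 0 ≤ β i) (ht : 0 < t) :
    ∃ Φ, IsDominatedKernel (orthantVolume d) (modifiedHeatKernel β t) Φ := by
  obtain ⟨Φ, hΦ⟩ := exists_isDominatedKernel_laguerreHeatKernel hβ ht
  exact ⟨Φ, hΦ.const_mul (Real.exp_nonneg _) (Real.exp_le_one_iff.2 (by linarith))⟩

theorem integral_modifiedHeatKernel_le (hβ : ∀ i, 0 ≤ β i) (ht : 0 < t) :
    ∀ᵐ x ∂(orthantVolume d), ∫ y, modifiedHeatKernel β t x y ∂(orthantVolume d) ≤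
      Real.exp (-t / 2) * (Real.cosh (t / 2) ^ d)⁻¹ := by
  filter_upwards [ae_mem_posOrthant d] with x hx
  simp only [modifiedHeatKernel, integral_const_mul]
  exact mul_le_mul_of_nonneg_left (integral_laguerreHeatKernel_le hβ ht hx) (Real.exp_nonneg _)

theorem exp_neg_mul_inv_cosh_pow_lt_one (d : ℕ) (ht : 0 < t) :
    Real.exp (-t / 2) * (Real.cosh (t / 2) ^ d)⁻¹ < 1 :=
  mul_lt_one_of_nonneg_of_lt_one_left (Real.exp_nonneg _)
    (Real.exp_lt_one_iff.2 (by linarith))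
    (inv_le_one_of_one_le₀ (one_le_pow₀ (Real.one_le_cosh _)))

theorem integral_modifiedHeatKernel_lt_one (hβ : ∀ i, 0 ≤ β i) (ht : 0 < t) :
    ∀ᵐ x ∂(orthantVolume d), ∫ y, modifiedHeatKernel β t x y ∂(orthantVolume d) < 1 := by
  filter_upwards [integral_modifiedHeatKernel_le hβ ht] with x hx
  exact hx.trans_lt (exp_neg_mul_inv_cosh_pow_lt_one d ht)

theorem integral_modifiedHeatKernel_mul_ae_eq (hβ : ∀ i, 0 ≤ β i) {s : ℝ} (hs : 0 < s)
    (ht : 0 < t) {x : Fin d → ℝ} (hx : x ∈ posOrthant d) :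
    (fun y => ∫ z, modifiedHeatKernel β s x z * modifiedHeatKernel β t z y ∂(orthantVolume d))
      =ᵐ[orthantVolume d] modifiedHeatKernel β (s + t) x := by
  filter_upwards [integral_laguerreHeatKernel_mul_ae_eq hβ hs ht hx] with y hy
  have kernel_mul (z : Fin d → ℝ) : modifiedHeatKernel β s x z * modifiedHeatKernel β t z y =
      Real.exp (-(s + t) / 2) * (laguerreHeatKernel β s x z * laguerreHeatKernel β t z y) := by
    rw [modifiedHeatKernel, modifiedHeatKernel, mul_mul_mul_comm, ← Real.exp_add, neg_add, add_div]
  simp only [kernel_mul]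
  rw [integral_const_mul, hy, modifiedHeatKernel]

theorem integral_modifiedHeatKernel_mul_laguerreFunPi (hβ : ∀ i, 0 ≤ β i) (ht : 0 < t)
    {x : Fin d → ℝ} (hx : x ∈ posOrthant d) (k : Fin d → ℕ) :
    ∫ y, modifiedHeatKernel β t x y * laguerreFunPi β k y ∂(orthantVolume d) =
      Real.exp (-t * (laguerreEigenvalue β (∑ i, k i) + 1 / 2)) * laguerreFunPi β k x := by
  simp only [modifiedHeatKernel, mul_assoc]
  rw [integral_const_mul, integral_laguerreHeatKernel_mul_laguerreFunPi hβ ht hx, ← mul_assoc,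
    ← Real.exp_add]
  ring_nf

theorem integral_laguerreFunPi_smul_kernelOp (hβ : ∀ i, 0 ≤ β i) (ht : 0 < t)
    {f : (Fin d → ℝ) → 𝕜} (hf : f ∈ LOneAddLInfty 𝕜 (orthantVolume d)) (k : Fin d → ℕ) :
    ∫ x, laguerreFunPi β k x • kernelOp (orthantVolume d) (modifiedHeatKernel β t) f x
        ∂(orthantVolume d) =
      Real.exp (-t * (laguerreEigenvalue β (∑ i, k i) + 1 / 2)) •
        ∫ x, laguerreFunPi β k x • f x ∂(orthantVolume d) := by
  have neg_one_lt (i : Fin d) : -1 < β i := by linarith [hβ i]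
  obtain ⟨Φ, hΦ⟩ := exists_isDominatedKernel_modifiedHeatKernel hβ ht
  have laguerreFunPi_mem := mem_LOneAddLInfty_of_memLp one_le_two
    ((memLp_laguerreFunPi neg_one_lt k).ofReal (K := 𝕜))
  have adjoint := hΦ.integral_kernelOp_mul laguerreFunPi_mem hf
  simp only [← RCLike.real_smul_eq_coe_mul] at adjoint
  rw [← adjoint, ← integral_smul]
  refine integral_congr_ae ?_
  filter_upwards [ae_mem_posOrthant d] with x hx
  rw [kernelOp_ofReal]
  simp only [kernelOp, smul_eq_mul]
  rw [integral_modifiedHeatKernel_mul_laguerreFunPi hβ ht hx, RCLike.ofReal_mul, mul_assoc,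
    RCLike.real_smul_eq_coe_mul, RCLike.real_smul_eq_coe_mul]

end ModifiedHeatKernel

section ModifiedLaguerre

variable {d : ℕ} {𝕜 : Type*} [RCLike 𝕜] {α : Fin d → ℝ} {j : Fin d}

instance instNeZeroOrthantVolume : NeZero (orthantVolume d) := by
  have isOpen_posOrthant : IsOpen (posOrthant d) := by
    rw [posOrthant_eq_pi]
    exact isOpen_set_pi Set.finite_univ fun _ _ => isOpen_Ioi
  have measure_pos : 0 < volume (posOrthant d) :=
    isOpen_posOrthant.measure_pos volume ⟨fun _ => 1, fun _ => one_pos⟩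
  exact ⟨by rw [orthantVolume, Ne, Measure.restrict_eq_zero]; exact measure_pos.ne'⟩

theorem laguerreEigenvalue_nonneg {β : Fin d → ℝ} (hβ : ∀ i, 0 ≤ β i) (n : ℕ) :
    0 ≤ laguerreEigenvalue β n := by
  have sum_nonneg : 0 ≤ ∑ i, β i := Finset.sum_nonneg fun i _ => hβ i
  rw [laguerreEigenvalue]
  positivity

theorem shiftOrder_nonneg (hj : -1 ≤ α j) (hi : ∀ i, i ≠ j → 0 ≤ α i) (i : Fin d) :
    0 ≤ shiftOrder α j i := by
  rcases eq_or_ne i j with rfl | hij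
  · rw [shiftOrder, Pi.add_apply, Pi.single_eq_same]
    linarith
  · rw [shiftOrder, Pi.add_apply, Pi.single_eq_of_ne hij, add_zero]
    exact hi i hij

theorem modifiedLaguerre_ae_eq_kernelOp (hβ : ∀ i, 0 ≤ shiftOrder α j i) {t : ℝ≥0} (ht : 0 < t)
    (f : (Fin d → ℝ) → 𝕜) : modifiedLaguerre α j t f =ᵐ[orthantVolume d]
      kernelOp (orthantVolume d) (modifiedHeatKernel (shiftOrder α j) t) f := by
  filter_upwards [ae_mem_posOrthant d] with x hx
  simp only [modifiedLaguerre, if_neg ht.ne', kernelOp, modifiedHeatKernel, mul_smul, integral_smul]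
  congr 1
  refine integral_congr_ae ?_
  filter_upwards [laguerreKernel_ae_eq_laguerreHeatKernel hβ (NNReal.coe_pos.2 ht) hx] with y hy
  rw [hy]

theorem isKernelSemigroup_modifiedLaguerre (hβ : ∀ i, 0 ≤ shiftOrder α j i) :
    IsKernelSemigroup (𝕜 := 𝕜) (orthantVolume d)
      (fun t => modifiedHeatKernel (shiftOrder α j) t) (modifiedLaguerre α j) where
  exists_isDominatedKernel _ ht :=
    exists_isDominatedKernel_modifiedHeatKernel hβ (NNReal.coe_pos.2 ht)
  integral_le_one _ ht :=
    (integral_modifiedHeatKernel_lt_one hβ (NNReal.coe_pos.2 ht)).mono fun _ => le_of_lt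
  integral_mul_ae_eq _ _ hs ht := (ae_mem_posOrthant d).mono fun _ =>
    integral_modifiedHeatKernel_mul_ae_eq hβ (NNReal.coe_pos.2 hs) (NNReal.coe_pos.2 ht)
  zero_apply _ := if_pos rfl
  ae_eq_kernelOp _ := modifiedLaguerre_ae_eq_kernelOp hβ

theorem integrable_laguerreKernel_smul {β : Fin d → ℝ} (hβ : ∀ i, 0 ≤ β i) {t : ℝ} (ht : 0 < t)
    {x : Fin d → ℝ} (hx : x ∈ posOrthant d) {f : (Fin d → ℝ) → 𝕜}
    (hf : f ∈ LOneAddLInfty 𝕜 (orthantVolume d)) :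
    Integrable (fun y => laguerreKernel β t x y • f y) (orthantVolume d) := by
  obtain ⟨Φ, hΦ⟩ := exists_isDominatedKernel_laguerreHeatKernel hβ ht
  refine (hΦ.integrable_smul hf x).congr ?_
  filter_upwards [laguerreKernel_ae_eq_laguerreHeatKernel hβ ht hx] with y hy
  rw [hy]

theorem integral_laguerreFunPi_smul_modifiedLaguerre (hβ : ∀ i, 0 ≤ shiftOrder α j i) (t : ℝ≥0)
    {f : (Fin d → ℝ) → 𝕜} (hf : f ∈ LOneAddLInfty 𝕜 (orthantVolume d)) (k : Fin d → ℕ) :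
    ∫ x, laguerreFunPi (shiftOrder α j) k x • modifiedLaguerre α j t f x ∂(orthantVolume d) =
      Real.exp (-(t : ℝ) * (laguerreEigenvalue (shiftOrder α j) (∑ i, k i) + 1 / 2)) •
        ∫ x, laguerreFunPi (shiftOrder α j) k x • f x ∂(orthantVolume d) := by
  rcases eq_zero_or_pos t with rfl | ht
  · simp only [(isKernelSemigroup_modifiedLaguerre hβ).zero_apply, NNReal.coe_zero, neg_zero,
      zero_mul, Real.exp_zero, one_smul]
  rw [← integral_laguerreFunPi_smul_kernelOp hβ (NNReal.coe_pos.2 ht) hf]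
  refine integral_congr_ae ?_
  filter_upwards [modifiedLaguerre_ae_eq_kernelOp hβ ht f] with x hx
  rw [hx]

theorem tendsto_eLpNorm_modifiedLaguerre_sub_partialSum (hβ : ∀ i, 0 ≤ shiftOrder α j i) (t : ℝ≥0)
    {f : (Fin d → ℝ) → 𝕜} (hf : MemLp f 2 (orthantVolume d)) :
    Tendsto (fun N => eLpNorm (modifiedLaguerre α j t f - modifiedSpectralPartialSum α j t f N)
        2 (orthantVolume d)) atTop (𝓝 0) := by
  have neg_one_lt (i : Fin d) : -1 < shiftOrder α j i := by linarith [hβ i]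
  have expansion := tendsto_eLpNorm_sub_sum_laguerreFunPi neg_one_lt
    ((isKernelSemigroup_modifiedLaguerre hβ).memLp_apply t one_le_two hf)
  refine expansion.congr fun N => ?_
  congr 2
  funext x
  rw [sum_multiIndexLT, modifiedSpectralPartialSum]
  refine Finset.sum_congr rfl fun n _ => ?_
  rw [Finset.smul_sum]
  refine Finset.sum_congr rfl fun k hk => ?_
  rw [integral_laguerreFunPi_smul_modifiedLaguerre hβ t
    (mem_LOneAddLInfty_of_memLp one_le_two hf), (Finset.mem_piAntidiag.1 hk).1, smul_comm]

theorem tendsto_eLpNorm_modifiedLaguerre_sub (hβ : ∀ i, 0 ≤ shiftOrder α j i)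
    {f : (Fin d → ℝ) → 𝕜} (hf : MemLp f 2 (orthantVolume d)) :
    Tendsto (fun t : ℝ≥0 => eLpNorm (modifiedLaguerre α j t f - f) 2 (orthantVolume d))
      (𝓝[>] 0) (𝓝 0) := by
  have neg_one_lt (i : Fin d) : -1 < shiftOrder α j i := by linarith [hβ i]
  have eigenvalue_nonneg (k : Fin d → ℕ) :
      0 ≤ laguerreEigenvalue (shiftOrder α j) (∑ i, k i) + 1 / 2 :=
    add_nonneg (laguerreEigenvalue_nonneg hβ _) one_half_pos.le
  have memLp_apply (t : ℝ≥0) : MemLp (modifiedLaguerre α j t f) 2 (orthantVolume d) :=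
    (isKernelSemigroup_modifiedLaguerre hβ).memLp_apply t one_le_two hf
  have tendsto_toLp : Tendsto (fun t => (memLp_apply t).toLp) (𝓝 0) (𝓝 hf.toLp) := by
    refine tendsto_of_repr_eq_exp_smul (laguerreBasis 𝕜 neg_one_lt) eigenvalue_nonneg
      fun t k => ?_
    rw [laguerreBasis_repr_toLp, laguerreBasis_repr_toLp,
      integral_laguerreFunPi_smul_modifiedLaguerre hβ t (mem_LOneAddLInfty_of_memLp one_le_two hf)]
  have tendsto_enorm := (tendsto_sub_nhds_zero_iff.2 tendsto_toLp).enorm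
  simp only [← MemLp.toLp_sub, Lp.enorm_toLp, enorm_zero] at tendsto_enorm
  exact tendsto_enorm.mono_left nhdsWithin_le_nhds

end ModifiedLaguerre

theorem mainTheorem5 {𝕜 : Type*} [RCLike 𝕜] {d : ℕ} (j : Fin d) (α : Fin d → ℝ)
    (hj : -1 ≤ α j) (hi : ∀ i, i ≠ j → 0 ≤ α i) :
    -- the series of the kernel converges, and so do the integrals that define the operators
    (∀ t : ℝ≥0, 0 < t → ∀ x ∈ posOrthant d, ∀ y ∈ posOrthant d,
      Summable (laguerreKernelTerm (shiftOrder α j) t x y)) ∧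
    (∀ t : ℝ≥0, 0 < t → ∀ x ∈ posOrthant d, ∀ f ∈ LOneAddLInfty 𝕜 (orthantVolume d),
      Integrable (fun y => laguerreKernel (shiftOrder α j) t x y • f y) (orthantVolume d)) ∧
    -- on `L²` the operators are those of the spectrally defined semigroup
    (∀ t : ℝ≥0, ∀ f : (Fin d → ℝ) → 𝕜, MemLp f 2 (orthantVolume d) →
      Tendsto (fun N => eLpNorm (modifiedLaguerre α j t f - modifiedSpectralPartialSum α j t f N)
        2 (orthantVolume d)) atTop (𝓝 0)) ∧
    IsSubmarkovian (orthantVolume d) (LOneAddLInfty 𝕜 (orthantVolume d))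
      (modifiedLaguerre α j) ∧
    ¬ IsMarkovian (orthantVolume d) (LOneAddLInfty 𝕜 (orthantVolume d))
      (modifiedLaguerre (𝕜 := 𝕜) α j) ∧
    (∀ p : ℝ≥0∞, 1 ≤ p → ∀ t : ℝ≥0, 0 < t →
      lpOpNorm (orthantVolume d) p (modifiedLaguerre (𝕜 := 𝕜) α j t) ≤
        ENNReal.ofReal (Real.exp (-(t : ℝ) / 2) * (Real.cosh ((t : ℝ) / 2) ^ d)⁻¹)) := by
  have hβ := shiftOrder_nonneg hj hi
  have hT := isKernelSemigroup_modifiedLaguerre (𝕜 := 𝕜) hβ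
  exact ⟨fun t ht x hx y hy => summable_laguerreKernelTerm hβ (NNReal.coe_pos.2 ht) hx hy,
    fun t ht x hx f hf => integrable_laguerreKernel_smul hβ (NNReal.coe_pos.2 ht) hx hf,
    fun t f hf => tendsto_eLpNorm_modifiedLaguerre_sub_partialSum hβ t hf,
    hT.isSubmarkovian fun f hf => tendsto_eLpNorm_modifiedLaguerre_sub hβ hf,
    hT.not_isMarkovian one_pos (integral_modifiedHeatKernel_lt_one hβ one_pos) _,
    fun p hp t ht => hT.lpOpNorm_le ht (integral_modifiedHeatKernel_le hβ (NNReal.coe_pos.2 ht)) hp⟩
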